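/- Let $m\le n$ be natural numbers, let $\pi:\{1,\dots,m\}\to\{1,\dots,n\}$ be injective, and let $\beta\in\{\mathsf W,\mathsf E\}^m$ assign to each row $i$ (counted from the top) of an $m\times n$ grid of squares a type, West or East. A *nongeneric hybrid pipe dream* of type $\beta$ is a filling of the grid by the following tiles. In rows of either type one may use the blank tile, the horizontal tile (one strand joining the West and East sides) and the crossing tile (one strand joining West and East, one joining South and North). In rows of type $\mathsf W$ one may moreover use the elbow joining West and North, the elbow joining South and East, and the tile containing both of these elbows. In rows of type $\mathsf E$ one may moreover use the elbow joining East and North, the elbow joining South and West, and the vertical tile (one strand joining South and North). It is required that the strands form pipes such that * no pipe starts or terminates in the middle of the grid; * no two pipes cross (in a crossing tile) more than once; * in each row of type $\mathsf W$ a pipe enters from the West end and none exits from the East end; in each row of type $\mathsf E$ a pipe enters from the East end and none exits from the West end; * no pipe comes in from the South side. Thus exactly one pipe enters in each row, and each pipe exits on the North side. Number the pipes $1,\dots,m$ by their entry points, counterclockwise along the West and East sides starting from the Northwest corner (down the West side, then up the East side), and let $\varphi(i)$ be the number of the pipe entering in row $i$. The pipe dream has *connectivity* $\pi$ if for every $k$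 the pipe numbered $k$ exits the North side in column $\pi(k)$. Let $S_\pi\in\mathbb Z[x_1,\dots,x_m,y_1,\dots,y_n]$ be the sum, over all nongeneric hybrid pipe dreams of type $\beta$ with connectivity $\pi$, of the product over all positions $(i,j)$ of the following factors: $x_{\varphi(i)}-y_j$ if row $i$ has type $\mathsf W$ and the tile at $(i,j)$ is straight (horizontal or crossing); $x_{\varphi(i)}-y_j$ if row $i$ has type $\mathsf E$ and the tile at $(i,j)$ is blank; and $1$ otherwise. Let $\hat\pi\in\mathcal S_n$ be the minimal extension of $\pi$: $\hat\pi(i)=\pi(i)$ for $1\le i\le m$ and $\hat\pi(m+k)=j_k$ for $1\le k\le n-m$, where $j_1<\dots<j_{n-m}$ are the elements of $\{1,\dots,n\}$ not in the image of $\pi$. Double Schubert polynomials $\mathfrak S_w\in\mathbb Z[x_1,\dots,x_n,y_1,\dots,y_n]$, $w\in\mathcal S_n$, are determined by $\mathfrak S_{w_0}=\prod_{i+j\le n}(x_i-y_j)$ for $w_0=(n,n-1,\dots,1)$ and $\mathfrak S_w=\partial_i\,\mathfrak S_{w r_i}$ whenever $w(i)<w(i+1)$, where $r_i=(i\ \,i{+}1)$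 and $\partial_i f=(f-r_if)/(x_i-x_{i+1})$, with $r_i$ exchanging $x_i$ and $x_{i+1}$. **Proposition.** For every $\beta\in\{\mathsf W,\mathsf E\}^m$, one has $S_\pi=\mathfrak S_{\hat\pi}$ in $\mathbb Z[x_1,\dots,x_n,y_1,\dots,y_n]$. -/

import Mathlib

open Finset

namespace HybridPipeDream

/-! ### Tiles -/

/-- The type of a row: pipes enter a row of type `west` from the West, and a row of type `east`
from the East. -/
inductive RowType
  | west
  | east
  deriving DecidableEq

/-- The four sides of a square tile. -/
inductive Side
  | N
  | E
  | S
  | W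
  deriving DecidableEq

/-- The side of the neighbouring tile that is glued to a given side. -/
def Side.opp : Side → Side
  | .N => .S
  | .E => .W
  | .S => .N
  | .W => .E

/-- The ten tiles. An elbow is named after the two sides that it joins. -/
inductive Tile
  | blank
  | horiz
  | vert
  | cross
  | elbowWN
  | elbowSE
  | bumpWNSE
  | elbowEN
  | elbowSW
  | bumpENSW
  deriving DecidableEq

instance : Fintype Tile where
  elems := {.blank, .horiz, .vert, .cross, .elbowWN, .elbowSE, .bumpWNSE, .elbowEN, .elbowSW,
    .bumpENSW}
  complete t := by cases t <;> simp

/-- `t.other s` is the side at the other end of the strand of the tile `t` that touches the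
side `s`, and `none` if no strand touches `s`. -/
def Tile.other : Tile → Side → Option Side
  | .blank, _ => none
  | .horiz, .W => some .E
  | .horiz, .E => some .W
  | .horiz, _ => none
  | .vert, .S => some .N
  | .vert, .N => some .S
  | .vert, _ => none
  | .cross, s => some s.opp
  | .elbowWN, .W => some .N
  | .elbowWN, .N => some .W
  | .elbowWN, _ => none
  | .elbowSE, .S => some .E
  | .elbowSE, .E => some .S
  | .elbowSE, _ => none
  | .bumpWNSE, .W => some .N
  | .bumpWNSE, .N => some .W
  | .bumpWNSE, .S => some .E
  | .bumpWNSE, .E => some .S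
  | .elbowEN, .E => some .N
  | .elbowEN, .N => some .E
  | .elbowEN, _ => none
  | .elbowSW, .S => some .W
  | .elbowSW, .W => some .S
  | .elbowSW, _ => none
  | .bumpENSW, .E => some .N
  | .bumpENSW, .N => some .E
  | .bumpENSW, .S => some .W
  | .bumpENSW, .W => some .S

/-- The side `s` of the tile `t` is touched by a pipe. -/
def Tile.Touches (t : Tile) (s : Side) : Prop := t.other s ≠ none

/-- The straight tiles. -/
def Tile.IsStraight : Tile → Prop
  | .cross => True
  | .horiz => True
  | .vert => True
  | _ => False

/-- The tiles that a nongeneric hybrid pipe dream may use in a row of the given type: in rows of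
type `west` the vertical tile is forbidden, in rows of type `east` the double elbow is. -/
def Tile.Allowed : RowType → Tile → Prop
  | .west, .bumpWNSE => True
  | .west, .elbowWN => True
  | .west, .elbowSE => True
  | .west, .cross => True
  | .west, .horiz => True
  | .west, .blank => True
  | .east, .elbowSW => True
  | .east, .elbowEN => True
  | .east, .cross => True
  | .east, .horiz => True
  | .east, .vert => True
  | .east, .blank => True
  | _, _ => False

/-! ### Fillings and their pipes -/

/-- A filling of the `m × n` grid; row `0` is the top row, column `0` the leftmost column. -/
abbrev Filling (m n : ℕ) := Fin m → Fin n → Tile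

/-- `Neighbor s i j i' j'`: the cell `(i', j')` is glued to the side `s` of the cell `(i, j)`. -/
def Neighbor {m n : ℕ} (s : Side) (i : Fin m) (j : Fin n) (i' : Fin m) (j' : Fin n) : Prop :=
  match s with
  | .N => i'.val + 1 = i.val ∧ j' = j
  | .S => i'.val = i.val + 1 ∧ j' = j
  | .E => i' = i ∧ j'.val = j.val + 1
  | .W => i' = i ∧ j'.val + 1 = j.val

/-- A place on a pipe: the pipe enters the tile in position `(row, col)` through `side`. -/
structure Place (m n : ℕ) where
  row : Fin m
  col : Fin n
  side : Side

/-- The pipe that is at the place `p` leaves the tile there and is next at the place `q`. -/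
def Step {m n : ℕ} (D : Filling m n) (p q : Place m n) : Prop :=
  ∃ s : Side, (D p.row p.col).other p.side = some s ∧
    Neighbor s p.row p.col q.row q.col ∧ q.side = s.opp

/-- `p` is the place where the pipe of row `r` enters the grid. -/
def IsEntry {m n : ℕ} (β : Fin m → RowType) (r : Fin m) (p : Place m n) : Prop :=
  p.row = r ∧
    ((β r = .west ∧ p.col.val = 0 ∧ p.side = .W) ∨
      (β r = .east ∧ p.col.val + 1 = n ∧ p.side = .E))

/-- The pipe that enters the grid in row `r` passes through the place `p`. -/
def Visits {m n : ℕ} (β : Fin m → RowType) (D : Filling m n) (r : Fin m) (p : Place m n) : Prop :=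
  ∃ p₀ : Place m n, IsEntry β r p₀ ∧ Relation.ReflTransGen (Step D) p₀ p

/-- The pipe that enters the grid in row `r` leaves it on the North side, in column `c`. -/
def ExitsAt {m n : ℕ} (β : Fin m → RowType) (D : Filling m n) (r : Fin m) (c : Fin n) : Prop :=
  ∃ p : Place m n, Visits β D r p ∧ p.row.val = 0 ∧ p.col = c ∧
    (D p.row p.col).other p.side = some .N

/-- The pipes that enter the grid in rows `r` and `r'` cross in the tile `(i, j)`. -/
def CrossAt {m n : ℕ} (β : Fin m → RowType) (D : Filling m n) (r r' : Fin m)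
    (i : Fin m) (j : Fin n) : Prop :=
  r ≠ r' ∧ D i j = .cross ∧ (∃ s, Visits β D r ⟨i, j, s⟩) ∧ (∃ s, Visits β D r' ⟨i, j, s⟩)

/-- Nongeneric hybrid pipe dreams of type `β`. -/
structure IsHybridPipeDream {m n : ℕ} (β : Fin m → RowType) (D : Filling m n) : Prop where
  /-- Only the tiles allowed in the row are used. -/
  allowed : ∀ i j, (D i j).Allowed (β i)
  /-- No pipe starts or terminates in the middle of the grid. -/
  matching : ∀ s i j i' j', Neighbor s i j i' j' →
    ((D i j).Touches s ↔ (D i' j').Touches s.opp)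
  /-- In rows of type `west`, a pipe enters from the West end, in rows of type `east`, no pipe
  exits there. -/
  west_end : ∀ i j, j.val = 0 → ((D i j).Touches .W ↔ β i = .west)
  /-- In rows of type `east`, a pipe enters from the East end, in rows of type `west`, no pipe
  exits there. -/
  east_end : ∀ i j, j.val + 1 = n → ((D i j).Touches .E ↔ β i = .east)
  /-- No pipe comes in from the South side. -/
  south_end : ∀ i j, i.val + 1 = m → ¬ (D i j).Touches .S
  /-- No two pipes cross twice. -/
  no_double_crossing : ∀ r r' i j i' j', CrossAt β D r r' i j → CrossAt β D r r' i' j' →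
    i = i' ∧ j = j'

/-! ### Numbering of the pipes, connectivity, and the sum over pipe dreams -/

/-- Going counterclockwise around the grid from its Northwest corner (down the West side and then
up the East side), the entry of row `r'` is met before the entry of row `r`. -/
def EntersBefore {m : ℕ} (β : Fin m → RowType) (r' r : Fin m) : Prop :=
  match β r', β r with
  | .west, .west => r' < r
  | .west, .east => True
  | .east, .west => False
  | .east, .east => r < r'

theorem not_entersBefore_self {m : ℕ} (β : Fin m → RowType) (r : Fin m) :
    ¬ EntersBefore β r r := by
  unfold EntersBefore
  cases h : β r <;> simp

open Classical in
/-- The number (counted from `0`) of the pipe that enters the grid in row `r`, where the pipes are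
numbered counterclockwise along the West and East sides, starting from the Northwest corner. -/
noncomputable def pipeNumber {m : ℕ} (β : Fin m → RowType) (r : Fin m) : Fin m :=
  ⟨(univ.filter fun r' => EntersBefore β r' r).card, by
    have h : (univ.filter fun r' => EntersBefore β r' r) ⊂ univ :=
      Finset.filter_ssubset.2 ⟨r, mem_univ r, not_entersBefore_self β r⟩
    simpa using Finset.card_lt_card h⟩

/-- The connectivity of the filling is `π`: the pipe numbered `k` exits the North side in
column `π k`. -/
def HasConnectivity {m n : ℕ} (β : Fin m → RowType) (D : Filling m n) (π : Fin m ↪ Fin n) : Prop :=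
  ∀ r : Fin m, ExitsAt β D r (π (pipeNumber β r))

open MvPolynomial in
open Classical in
/-- The factor contributed by a tile in row `i` and column `j`, in the polynomial ring in the
variables `x k = X (Sum.inl k)` and `y j = X (Sum.inr j)`. -/
noncomputable def tileWeight {m n : ℕ} (β : Fin m → RowType) (i : Fin m) (j : Fin n) (t : Tile) :
    MvPolynomial (Fin m ⊕ Fin n) ℤ :=
  match β i with
  | .west => if t.IsStraight then X (Sum.inl (pipeNumber β i)) - X (Sum.inr j) else 1
  | .east => if t = .blank then X (Sum.inl (pipeNumber β i)) - X (Sum.inr j) else 1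

open Classical in
/-- The sum `S_π` over the nongeneric hybrid pipe dreams of type `β` with connectivity `π`. -/
noncomputable def pipeDreamSum {m n : ℕ} (β : Fin m → RowType) (π : Fin m ↪ Fin n) :
    MvPolynomial (Fin m ⊕ Fin n) ℤ :=
  ∑ D ∈ (univ : Finset (Filling m n)).filter
      (fun D => IsHybridPipeDream β D ∧ HasConnectivity β D π),
    ∏ i, ∏ j, tileWeight β i j (D i j)

/-! ### The minimal extension -/

/-- The columns that are not in the image of `π`. -/
def zeroColumns {m n : ℕ} (π : Fin m ↪ Fin n) : Finset (Fin n) := (univ.map π)ᶜ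

theorem card_zeroColumns {m n : ℕ} (π : Fin m ↪ Fin n) : (zeroColumns π).card = n - m := by
  simp [zeroColumns, card_compl]

/-- The one-line notation of the minimal extension: first the values of `π`, then the columns not
in the image of `π`, in increasing order. -/
def minimalExtensionFun {m n : ℕ} (π : Fin m ↪ Fin n) (i : Fin n) : Fin n :=
  if h : i.val < m then π ⟨i.val, h⟩
  else (zeroColumns π).orderEmbOfFin (card_zeroColumns π) ⟨i.val - m, by omega⟩

theorem minimalExtensionFun_injective {m n : ℕ} (π : Fin m ↪ Fin n) :
    Function.Injective (minimalExtensionFun π) := by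
  have key : ∀ (k : Fin m) (l : Fin (n - m)),
      π k ≠ (zeroColumns π).orderEmbOfFin (card_zeroColumns π) l := by
    intro k l h
    have h1 := (zeroColumns π).orderEmbOfFin_mem (card_zeroColumns π) l
    rw [← h] at h1
    simp [zeroColumns] at h1
  intro a b hab
  unfold minimalExtensionFun at hab
  split_ifs at hab with ha hb hb
  · have := π.injective hab
    simp only [Fin.mk.injEq] at this
    exact Fin.ext this
  · exact absurd hab (key _ _)
  · exact absurd hab.symm (key _ _)
  · have := ((zeroColumns π).orderEmbOfFin (card_zeroColumns π)).injective hab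
    simp only [Fin.mk.injEq] at this
    exact Fin.ext (by omega)

/-- The minimal extension of `π` to a permutation. -/
noncomputable def minimalExtension {m n : ℕ} (π : Fin m ↪ Fin n) : Equiv.Perm (Fin n) :=
  Equiv.ofBijective (minimalExtensionFun π)
    (Finite.injective_iff_bijective.1 (minimalExtensionFun_injective π))

end HybridPipeDream

/-! ### Double Schubert polynomials -/

namespace DoubleSchubert

open MvPolynomial

/-- Exchange of the variables `x i` and `x j`. -/
noncomputable def swapX {n : ℕ} (i j : Fin n) (f : MvPolynomial (Fin n ⊕ Fin n) ℤ) :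
    MvPolynomial (Fin n ⊕ Fin n) ℤ :=
  rename (Sum.map (Equiv.swap i j) id) f

theorem sub_dvd_sub_swapX {n : ℕ} (i j : Fin n) (f : MvPolynomial (Fin n ⊕ Fin n) ℤ) :
    (X (Sum.inl i) - X (Sum.inl j) : MvPolynomial (Fin n ⊕ Fin n) ℤ) ∣ f - swapX i j f := by
  induction f using MvPolynomial.induction_on with
  | C a => simp [swapX]
  | add p q hp hq =>
    have : p + q - swapX i j (p + q) = (p - swapX i j p) + (q - swapX i j q) := by
      simp only [swapX, map_add]; ring
    rw [this]; exact dvd_add hp hq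
  | mul_X p k hp =>
    have : p * X k - swapX i j (p * X k) =
        (p - swapX i j p) * X k + swapX i j p * (X k - swapX i j (X k)) := by
      simp only [swapX, map_mul]; ring
    rw [this]
    refine dvd_add (hp.mul_right _) (Dvd.dvd.mul_left ?_ _)
    rcases k with k | k
    · by_cases h1 : k = i
      · subst h1; simp [swapX]
      · by_cases h2 : k = j
        · subst h2
          simp only [swapX, rename_X, Sum.map_inl, Equiv.swap_apply_right]
          exact (dvd_sub_comm).1 dvd_rfl
        · simp [swapX, Equiv.swap_apply_of_ne_of_ne h1 h2]
    · simp [swapX]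

/-- The divided difference `(f - f with x i and x j exchanged) / (x i - x j)`. For `i ≠ j` it is
the unique polynomial `g` such that `f - swapX i j f = (x i - x j) * g`. -/
noncomputable def dividedDifference {n : ℕ} (i j : Fin n)
    (f : MvPolynomial (Fin n ⊕ Fin n) ℤ) : MvPolynomial (Fin n ⊕ Fin n) ℤ :=
  (sub_dvd_sub_swapX i j f).choose

/-- `p` is a pair of consecutive positions `i`, `i + 1`, and `w` has an ascent there. -/
def IsAscent {n : ℕ} (w : Equiv.Perm (Fin n)) (p : Fin n × Fin n) : Prop :=
  p.2.val = p.1.val + 1 ∧ w p.1 < w p.2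

theorem IsAscent.measure_lt {n : ℕ} {w : Equiv.Perm (Fin n)} {p : Fin n × Fin n}
    (h : IsAscent w p) :
    ∑ a, a.val * ((w * Equiv.swap p.1 p.2) a).val < ∑ a, a.val * (w a).val := by
  obtain ⟨i, j⟩ := p
  obtain ⟨h1, h2⟩ := h
  simp only at h1 h2 ⊢
  have hij : i ≠ j := fun e => by rw [e] at h1; omega
  have hj : j ∈ univ.erase i := by simp [hij.symm]
  rw [← Finset.add_sum_erase _ _ (mem_univ i), ← Finset.add_sum_erase _ _ hj,
    ← Finset.add_sum_erase _ (fun a => a.val * (w a).val) (mem_univ i),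
    ← Finset.add_sum_erase _ (fun a => a.val * (w a).val) hj]
  have hs : ∑ a ∈ (univ.erase i).erase j, a.val * ((w * Equiv.swap i j) a).val =
      ∑ a ∈ (univ.erase i).erase j, a.val * (w a).val := by
    refine Finset.sum_congr rfl fun a ha => ?_
    simp only [mem_erase, mem_univ, and_true] at ha
    rw [Equiv.Perm.mul_apply, Equiv.swap_apply_of_ne_of_ne ha.2 ha.1]
  rw [hs]
  simp only [Equiv.Perm.mul_apply, Equiv.swap_apply_left, Equiv.swap_apply_right]
  have h3 : (w i).val < (w j).val := h2
  rw [h1]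
  nlinarith

open Classical in
/-- The double Schubert polynomial of `w`: for the longest permutation (the one without ascents)
it is the product of the `x i - y j` with `i + j ≤ n` (for indices counted from `1`), and if `w`
has an ascent in positions `i, i + 1` it is the divided difference, with respect to `x i` and
`x (i + 1)`, of the double Schubert polynomial of `w * (i i+1)`. (The result does not depend on
the ascents that are used.) Here `x i = X (Sum.inl i)` and `y j = X (Sum.inr j)`. -/
noncomputable def doubleSchubert {n : ℕ} (w : Equiv.Perm (Fin n)) :
    MvPolynomial (Fin n ⊕ Fin n) ℤ :=
  if h : ∃ p : Fin n × Fin n, IsAscent w p then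
    dividedDifference h.choose.1 h.choose.2
      (doubleSchubert (w * Equiv.swap h.choose.1 h.choose.2))
  else
    ∏ p ∈ (univ : Finset (Fin n × Fin n)).filter (fun p => p.1.val + p.2.val + 2 ≤ n),
      (X (Sum.inl p.1) - X (Sum.inr p.2))
termination_by ∑ a, a.val * (w a).val
decreasing_by exact h.choose_spec.measure_lt

end DoubleSchubert

/-! The sum over pipe dreams is the partition function of a lattice model. Write on every edge of
the grid the number of the pipe that runs through it, and `⊤` if there is none. By `crossOrder_iff`,
no two pipes cross twice exactly when the two pipes of every crossing tile come in uncrossed. This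
is a condition on the labels of single tiles, so each row becomes a transfer operator (`westRow`,
`eastRow`) on the labels of a horizontal line, and the sum becomes `partitionFn`.

The heart is a relation of Yang–Baxter type (`westRow_exchange`, `eastRow_exchange`): exchanging `y
j` and `y (j + 1)` conjugates the row operator by `adjOp`, an operator that depends neither on `x`
nor on the type of the row. It therefore passes through any stack of rows (`partitionFn_swapSeq`).
For `m = n` this says that the partition functions, indexed by permutations, obey the divided
difference relations in the `y` variables. At the longest permutation the filling is forced and its
weight is the staircase product, whatever the types (`partitionFn_descList`).

These two facts determine the family, since the relations in `y` descend from the longest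
permutation to every other one. They also imply the relations in the `x` variables
(`sub_swapX_of_swapY`), because exchanges of `x` and of `y` variables commute and the two kinds of
relation agree at the longest permutation. So the family is that of the double Schubert polynomials
(`doubleSchubert_eq_of_swapY`).

For `m < n`, put `n - m` rows of type `east` on top. For the minimal extension their fillings are
forced and have weight `1` (`partitionFn_addEastRows`), which reduces the claim to permutations. -/

namespace HybridPipeDream

/-! ### The partition function of labelled rows -/

section Lattice

variable {R : Type*} [CommRing R]

/-- The sum, over the fillings of a row of type `west`, of the weight times the value of `F` at the
labels on the South side and the label on the West end; `⊤` is
the label of an edge without pipe, the list holds the labels on the North side. -/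
def westRow (x : R) : (ℕ → R) → List (WithTop ℕ) → (List (WithTop ℕ) → WithTop ℕ → R) → R
  | _, [], F => F [] ⊤
  | y, n :: l, F => westRow x (fun k => y (k + 1)) l
      -- Here `h` is the label on the East side of the first cell. The first summand collects the
      -- blank tile and the elbows, the second the horizontal tile (`n = ⊤`) and the crossing, whose
      -- pipes come in uncrossed when `h < n`. The value `⊤` in the base case says that no pipe
      -- exits on the East.
      (fun s h => F (h :: s) n + if h < n then (x - y 0) * F (n :: s) h else 0)

/-- The sum, over the fillings of a row of type `east` with label `h` on its West end, of the weight
times the value of `F` at the labels on the South side and the label on the East end. -/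
def eastRow (x : R) :
    (ℕ → R) → List (WithTop ℕ) → WithTop ℕ → (List (WithTop ℕ) → WithTop ℕ → R) → R
  | _, [], h, F => F [] h
  | y, n :: l, h, F =>
    -- The blank tile alone has a weight. Otherwise the first summand is a straight tile
    -- (horizontal, vertical or an uncrossed crossing) and the second a single elbow, which needs an
    -- empty edge because the double elbow is forbidden.
    if h = ⊤ ∧ n = ⊤ then (x - y 0) * eastRow x (fun k => y (k + 1)) l ⊤ (fun s => F (⊤ :: s))
    else (if n = ⊤ ∨ n < h then eastRow x (fun k => y (k + 1)) l h (fun s => F (n :: s)) else 0) +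
      if h = ⊤ ∨ n = ⊤ then eastRow x (fun k => y (k + 1)) l n (fun s => F (h :: s)) else 0

/-- The sum over the fillings with prescribed labels on the North side. A row is given by its
type and the label of the pipe that enters it. -/
def partitionFn (x y : ℕ → R) : List (RowType × ℕ) → List (WithTop ℕ) → R
  | [], l => if ∀ a ∈ l, a = ⊤ then 1 else 0
  | (.west, a) :: rows, l =>
    westRow (x a) y l fun s h => if h = a then partitionFn x y rows s else 0
  | (.east, a) :: rows, l =>
    eastRow (x a) y l ⊤ fun s h => if h = a then partitionFn x y rows s else 0

/-! ### Exchange of neighbouring columns -/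

/-- The operator on functions of a state that adds `c` times the value at the state with the
entries `j` and `j + 1` exchanged, if these form a descent. -/
def adjOp (c : R) : ℕ → (List (WithTop ℕ) → R) → List (WithTop ℕ) → R
  | 0, f, a :: b :: l => f (a :: b :: l) + if b < a then c * f (b :: a :: l) else 0
  | j + 1, f, a :: l => adjOp c j (fun s => f (a :: s)) l
  | _, f, l => f l

theorem adjOp_add (c : R) (j : ℕ) (f g : List (WithTop ℕ) → R) (l : List (WithTop ℕ)) :
    adjOp c j (fun s => f s + g s) l = adjOp c j f l + adjOp c j g l := by
  induction j generalizing f g l with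
  | zero =>
    rcases l with _ | ⟨a, _ | ⟨b, l⟩⟩ <;> simp only [adjOp]
    split_ifs <;> ring
  | succ j ih =>
    rcases l with _ | ⟨a, l⟩ <;> simp only [adjOp]
    exact ih _ _ _

theorem adjOp_mul (c d : R) (j : ℕ) (f : List (WithTop ℕ) → R) (l : List (WithTop ℕ)) :
    adjOp c j (fun s => d * f s) l = d * adjOp c j f l := by
  induction j generalizing f l with
  | zero =>
    rcases l with _ | ⟨a, _ | ⟨b, l⟩⟩ <;> simp only [adjOp]
    split_ifs <;> ring
  | succ j ih =>
    rcases l with _ | ⟨a, l⟩ <;> simp only [adjOp]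
    exact ih _ _

theorem adjOp_ite (c : R) (p : Prop) [Decidable p] (j : ℕ) (f : List (WithTop ℕ) → R)
    (l : List (WithTop ℕ)) :
    adjOp c j (fun s => if p then f s else 0) l = if p then adjOp c j f l else 0 := by
  by_cases hp : p
  · simp [hp]
  · simpa [hp] using adjOp_mul c 0 j f l

theorem westRow_add (x : R) (y : ℕ → R) (l : List (WithTop ℕ))
    (F G : List (WithTop ℕ) → WithTop ℕ → R) :
    westRow x y l (fun s h => F s h + G s h) = westRow x y l F + westRow x y l G := by
  induction l generalizing y F G with
  | nil => rfl
  | cons n l ih =>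
    simp only [westRow]
    rw [← ih]
    congr 1
    funext s h
    split_ifs <;> ring

theorem westRow_mul (x : R) (y : ℕ → R) (l : List (WithTop ℕ)) (c : R)
    (F : List (WithTop ℕ) → WithTop ℕ → R) :
    westRow x y l (fun s h => c * F s h) = c * westRow x y l F := by
  induction l generalizing y F with
  | nil => rfl
  | cons n l ih =>
    simp only [westRow]
    rw [← ih]
    congr 1
    funext s h
    split_ifs <;> ring

theorem eastRow_add (x : R) (y : ℕ → R) (l : List (WithTop ℕ)) (h : WithTop ℕ)
    (F G : List (WithTop ℕ) → WithTop ℕ → R) :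
    eastRow x y l h (fun s h => F s h + G s h) = eastRow x y l h F + eastRow x y l h G := by
  induction l generalizing y F G h with
  | nil => rfl
  | cons n l ih =>
    simp only [eastRow, ih]
    split_ifs <;> ring

theorem eastRow_mul (x : R) (y : ℕ → R) (l : List (WithTop ℕ)) (h : WithTop ℕ) (c : R)
    (F : List (WithTop ℕ) → WithTop ℕ → R) :
    eastRow x y l h (fun s h => c * F s h) = c * eastRow x y l h F := by
  induction l generalizing y F h with
  | nil => rfl
  | cons n l ih =>
    simp only [eastRow, ih]
    split_ifs <;> ring

theorem eastRow_zero (x : R) (y : ℕ → R) (l : List (WithTop ℕ)) (h : WithTop ℕ) :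
    eastRow x y l h (fun _ _ => 0) = 0 := by
  simpa using eastRow_mul x y l h 0 (fun _ _ => 0)

theorem westRow_zero (x : R) (y : ℕ → R) (l : List (WithTop ℕ)) :
    westRow x y l (fun _ _ => 0) = 0 := by
  simpa using westRow_mul x y l 0 (fun _ _ => 0)

/-- The sequence `y` with the terms `j` and `j + 1` exchanged. -/
def swapSeq {α : Type*} (y : ℕ → α) (j : ℕ) : ℕ → α := fun k => y (Equiv.swap j (j + 1) k)

theorem swapSeq_zero_shift {α : Type*} (y : ℕ → α) : (fun k => swapSeq y 0 (k + 1 + 1)) =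
    fun k => y (k + 1 + 1) := by
  funext k
  simp only [swapSeq]
  rw [Equiv.swap_apply_of_ne_of_ne (by omega) (by omega)]

theorem swapSeq_succ_shift {α : Type*} (y : ℕ → α) (j : ℕ) : (fun k => swapSeq y (j + 1) (k + 1)) =
    swapSeq (fun k => y (k + 1)) j := by
  funext k
  simp only [swapSeq, Equiv.swap_apply_def]
  congr 1
  split_ifs <;> omega

theorem swapSeq_succ_apply_zero {α : Type*} (y : ℕ → α) (j : ℕ) : swapSeq y (j + 1) 0 = y 0 := by
  simp only [swapSeq]
  rw [Equiv.swap_apply_of_ne_of_ne (by omega) (by omega)]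

theorem swapSeq_zero_apply_zero {α : Type*} (y : ℕ → α) : swapSeq y 0 0 = y 1 := by simp [swapSeq]

theorem swapSeq_zero_apply_one {α : Type*} (y : ℕ → α) : swapSeq y 0 (0 + 1) = y 0 := by simp [swapSeq]

/-- This is a local identity: induction moves the two exchanged columns to the front, and there both
sides are compared for each relative order of the two North labels and the label on the East of the
second cell. -/
theorem westRow_exchange (x : R) (j : ℕ) (y : ℕ → R) (l : List (WithTop ℕ))
    (hl : j + 1 < l.length) (F : List (WithTop ℕ) → WithTop ℕ → R) :
    westRow x (swapSeq y j) l (fun s h => adjOp (y j - y (j + 1)) j (fun s => F s h) s) =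
      adjOp (y j - y (j + 1)) j (fun l => westRow x y l F) l := by
  induction j generalizing y l F with
  | zero =>
    rcases l with _ | ⟨n₁, _ | ⟨n₂, l⟩⟩
    · simp at hl
    · simp at hl
    · simp only [westRow, adjOp, swapSeq_zero_shift, swapSeq_zero_apply_zero,
        swapSeq_zero_apply_one]
      -- The test for a descent moves inside the functional, so that both sides become one `westRow`
      -- over the remaining columns and the functionals can be compared pointwise.
      rw [← westRow_mul, show ∀ a b : R, (if n₂ < n₁ then a else b) =
        (if n₂ < n₁ then 1 else 0) * a + (if n₂ < n₁ then 0 else b) by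
          intro a b; split_ifs <;> ring, ← westRow_mul, ite_self, add_zero, ← westRow_add]
      congr 1
      funext s h
      rcases lt_trichotomy n₁ n₂ with h1 | h1 | h1 <;>
      rcases lt_trichotomy h n₁ with h2 | h2 | h2 <;>
      rcases lt_trichotomy h n₂ with h3 | h3 | h3 <;>
      first
        | (exfalso; order)
        | (simp only [h1, h2, h3, h1.not_gt, h2.not_gt, h3.not_gt, lt_irrefl, if_true, if_false]
           ring)
  | succ j ih =>
    rcases l with _ | ⟨n, l⟩
    · simp at hl
    · have hl' : j + 1 < l.length := by simpa using hl
      simp only [westRow, adjOp, swapSeq_succ_shift, swapSeq_succ_apply_zero]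
      rw [← ih (fun k => y (k + 1)) l hl']
      congr 1
      funext s h
      rw [adjOp_add, adjOp_ite, adjOp_mul]

/-- The same operator `adjOp` serves for both types of rows; this is why the answer does not depend
on the types. -/
theorem eastRow_exchange (x : R) (j : ℕ) (y : ℕ → R) (l : List (WithTop ℕ)) (h : WithTop ℕ)
    (hl : j + 1 < l.length) (F : List (WithTop ℕ) → WithTop ℕ → R) :
    eastRow x (swapSeq y j) l h (fun s h => adjOp (y j - y (j + 1)) j (fun s => F s h) s) =
      adjOp (y j - y (j + 1)) j (fun l => eastRow x y l h F) l := by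
  induction j generalizing y l F h with
  | zero =>
    rcases l with _ | ⟨n₁, _ | ⟨n₂, l⟩⟩
    · simp at hl
    · simp at hl
    · have key : ∀ a b e, eastRow x (fun k => y (k + 1 + 1)) l e (fun s h =>
          F (a :: b :: s) h + if b < a then (y 0 - y (0 + 1)) * F (b :: a :: s) h else 0) =
          eastRow x (fun k => y (k + 1 + 1)) l e (fun s => F (a :: b :: s)) + if b < a then
          (y 0 - y (0 + 1)) * eastRow x (fun k => y (k + 1 + 1)) l e (fun s => F (b :: a :: s))
          else 0 := by
        intro a b e
        split_ifs
        · rw [eastRow_add, eastRow_mul]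
        · simp
      simp only [eastRow, adjOp, swapSeq_zero_shift, swapSeq_zero_apply_zero,
        swapSeq_zero_apply_one, key]
      -- The identity concerns two columns only and holds for arbitrary values of the rest of the
      -- row.
      generalize eastRow x (fun k => y (k + 1 + 1)) l = G
      induction n₁ using WithTop.recTopCoe <;> induction n₂ using WithTop.recTopCoe <;>
        induction h using WithTop.recTopCoe <;>
        simp only [WithTop.coe_ne_top, WithTop.coe_lt_coe, WithTop.coe_lt_top, not_top_lt, if_true,
          if_false, and_true, and_false, or_true, or_false, false_or, add_zero, zero_add,
          lt_irrefl]
      all_goals first | ring1 | (split_ifs <;> first | ring1 | (exfalso; omega))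
  | succ j ih =>
    rcases l with _ | ⟨n, l⟩
    · simp at hl
    · have hl' : j + 1 < l.length := by simpa using hl
      simp only [eastRow, adjOp, swapSeq_succ_shift, swapSeq_succ_apply_zero]
      have ih' := fun h F => ih (fun k => y (k + 1)) l h hl' F
      rw [ih' ⊤ (fun s h => F (⊤ :: s) h), ih' h (fun s h => F (n :: s) h),
        ih' n (fun s h' => F (h :: s) h')]
      by_cases hc : h = ⊤ ∧ n = ⊤
      · simp only [if_pos hc, adjOp_mul]
      · simp only [if_neg hc, adjOp_add, adjOp_ite]

theorem westRow_congr (x : R) (y : ℕ → R) (l : List (WithTop ℕ))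
    {F G : List (WithTop ℕ) → WithTop ℕ → R} (hFG : ∀ s h, s.length = l.length → F s h = G s h) :
    westRow x y l F = westRow x y l G := by
  induction l generalizing y F G with
  | nil => exact hFG [] ⊤ rfl
  | cons n l ih =>
    simp only [westRow]
    refine ih _ fun s h hs => ?_
    rw [hFG _ _ (by simp [hs]), hFG (n :: s) h (by simp [hs])]

theorem eastRow_congr (x : R) (y : ℕ → R) (l : List (WithTop ℕ)) (h : WithTop ℕ)
    {F G : List (WithTop ℕ) → WithTop ℕ → R} (hFG : ∀ s h, s.length = l.length → F s h = G s h) :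
    eastRow x y l h F = eastRow x y l h G := by
  induction l generalizing y F G h with
  | nil => exact hFG [] h rfl
  | cons n l ih =>
    have key : ∀ a e, eastRow x (fun k => y (k + 1)) l e (fun s => F (a :: s)) =
        eastRow x (fun k => y (k + 1)) l e (fun s => G (a :: s)) := fun a e =>
      ih _ _ fun s h hs => hFG _ _ (by simp [hs])
    simp only [eastRow, key]

/-- A state with a descent has an entry other than `⊤`, and so does the exchanged state. This starts
the induction below the last row. -/
theorem adjOp_allTop (c : R) (j : ℕ) (l : List (WithTop ℕ)) :
    adjOp c j (fun l => if ∀ a ∈ l, a = ⊤ then 1 else 0) l =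
      if ∀ a ∈ l, a = ⊤ then 1 else 0 := by
  induction j generalizing l with
  | zero =>
    rcases l with _ | ⟨a, _ | ⟨b, l⟩⟩ <;> simp only [adjOp]
    by_cases hba : b < a
    · have hb : b ≠ ⊤ := (lt_of_lt_of_le hba le_top).ne
      simp [hb]
    · simp [hba]
  | succ j ih =>
    rcases l with _ | ⟨a, l⟩ <;> simp only [adjOp]
    by_cases ha : a = ⊤
    · simpa [ha] using ih l
    · simpa [ha] using adjOp_mul c 0 j (fun _ => (0 : R)) l

/-- `adjOp` is the identity on the empty boundary below the grid and commutes past one row after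
another, from the bottom to the top. -/
theorem partitionFn_swapSeq (x y : ℕ → R) (j : ℕ) (rows : List (RowType × ℕ))
    (l : List (WithTop ℕ)) (hl : j + 1 < l.length) :
    partitionFn x (swapSeq y j) rows l =
      adjOp (y j - y (j + 1)) j (partitionFn x y rows) l := by
  induction rows generalizing l with
  | nil => exact (adjOp_allTop _ _ _).symm
  | cons r rows ih =>
    rcases r with ⟨_ | _, a⟩
    · refine Eq.trans (westRow_congr _ _ _ fun s h hs => ?_) (westRow_exchange _ _ _ _ hl _)
      rw [ih s (by omega), adjOp_ite]
    · refine Eq.trans (eastRow_congr _ _ _ _ fun s h hs => ?_) (eastRow_exchange _ _ _ _ _ hl _)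
      rw [ih s (by omega), adjOp_ite]

theorem adjOp_ofFn (c : R) {n : ℕ} (j : ℕ) (hj : j + 1 < n) (f : List (WithTop ℕ) → R)
    (g : Fin n → WithTop ℕ) :
    adjOp c j f (List.ofFn g) = f (List.ofFn g) +
      if g ⟨j + 1, hj⟩ < g ⟨j, by omega⟩ then
        c * f (List.ofFn fun k => g (Equiv.swap ⟨j, by omega⟩ ⟨j + 1, hj⟩ k)) else 0 := by
  induction j generalizing n f with
  | zero =>
    obtain ⟨n, rfl⟩ : ∃ k, n = k + 2 := ⟨n - 2, by omega⟩
    simp only [List.ofFn_succ, adjOp]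
    congr 3
  | succ j ih =>
    obtain ⟨n, rfl⟩ : ∃ k, n = k + 1 := ⟨n - 1, by omega⟩
    simp only [List.ofFn_succ, adjOp]
    rw [ih (by omega)]
    congr 3
    have h0 : Equiv.swap (⟨j + 1, by omega⟩ : Fin (n + 1)) ⟨j + 1 + 1, hj⟩ 0 = 0 :=
      Equiv.swap_apply_of_ne_of_ne (by simp [Fin.ext_iff]) (by simp [Fin.ext_iff])
    rw [h0]
    congr 3
    funext k
    congr 1
    simp only [Equiv.swap_apply_def, Fin.ext_iff]
    split_ifs <;> simp_all

/-! ### Rows with forced fillings -/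

/-- Labels are conserved: the one on the East end must come from the West end or from the North
side. -/
theorem eastRow_eq_zero (x : R) (y : ℕ → R) (b : WithTop ℕ) (l : List (WithTop ℕ)) (h : WithTop ℕ)
    (F : List (WithTop ℕ) → WithTop ℕ → R) (hb : b ∉ l) (hh : h ≠ b)
    (hF : ∀ s (h' : WithTop ℕ), h' ≠ b → F s h' = 0) : eastRow x y l h F = 0 := by
  induction l generalizing y F h with
  | nil => exact hF _ _ hh
  | cons n l ih =>
    simp only [List.mem_cons, not_or] at hb
    have key : ∀ a e, e ≠ b → eastRow x (fun k => y (k + 1)) l e (fun s => F (a :: s)) = 0 :=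
      fun a e he => ih _ _ _ hb.2 he fun s h' => hF _ _
    simp only [eastRow, key _ h hh, key _ n (Ne.symm hb.1), ite_self, add_zero]
    split_ifs with hc
    · rw [key _ _ (hc.1 ▸ hh), mul_zero]
    · rfl

/-- The largest label, once on a horizontal edge, can run straight through all remaining cells at
weight `1`. Turning South at an empty column would keep it from the East end. -/
theorem eastRow_of_max (x : R) (y : ℕ → R) (b : ℕ) (l : List (WithTop ℕ))
    (F : List (WithTop ℕ) → WithTop ℕ → R) (hl : ∀ n ∈ l, n < b ∨ n = ⊤)
    (hF : ∀ s (h' : WithTop ℕ), h' ≠ b → F s h' = 0) : eastRow x y l b F = F l b := by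
  induction l generalizing y F with
  | nil => rfl
  | cons n l ih =>
    simp only [List.mem_cons, forall_eq_or_imp] at hl
    have hn : n = ⊤ ∨ n < b := hl.1.symm
    have hz : eastRow x (fun k => y (k + 1)) l n (fun s => F (b :: s)) = 0 := by
      refine eastRow_eq_zero _ _ b _ _ _ (fun hm => ?_) ?_ fun s h' => hF _ _
      · simpa using hl.2 _ hm
      · rintro rfl
        simp at hn
    simp only [eastRow, WithTop.natCast_ne_top, false_and, if_false, if_pos hn, hz, ite_self,
      add_zero]
    exact ih _ _ hl.2 fun s h' => hF _ _

/-- A finite label `h` on the horizontal edge can leave it only at an empty column, and there is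
none up to the column of `b`. So it still occupies the edge when `b` would have to turn onto it. -/
theorem eastRow_eq_zero_of_prefix (x : R) (y : ℕ → R) (b : ℕ) (p l : List (WithTop ℕ))
    (h : WithTop ℕ) (F : List (WithTop ℕ) → WithTop ℕ → R) (hp : ∀ n ∈ p, n ≠ ⊤)
    (hl : (b : WithTop ℕ) ∉ l) (hh : h ≠ b) (hh' : h ≠ ⊤)
    (hF : ∀ s (h' : WithTop ℕ), h' ≠ b → F s h' = 0) : eastRow x y (p ++ (b : WithTop ℕ) :: l) h F = 0 := by
  induction p generalizing y F with
  | nil =>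
    simp only [List.nil_append, eastRow, hh', WithTop.natCast_ne_top, false_and, or_false, if_false,
      add_zero]
    split_ifs
    · exact eastRow_eq_zero _ _ b _ _ _ hl hh fun s h' => hF _ _
    · rfl
  | cons n p ih =>
    simp only [List.mem_cons, forall_eq_or_imp] at hp
    simp only [List.cons_append, eastRow, hh', hp.1, false_and, or_false, if_false, add_zero]
    split_ifs
    · exact ih _ _ hp.2 fun s h' => hF _ _
    · rfl

/-- The only filling that contributes has vertical tiles up to the column of `b`, an elbow there,
and `b` running straight afterwards. If an earlier label turned onto the horizontal edge, it would
block `b`. -/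
theorem eastRow_of_prefix (x : R) (y : ℕ → R) (b : ℕ) (p l : List (WithTop ℕ))
    (F : List (WithTop ℕ) → WithTop ℕ → R) (hp : ∀ n ∈ p, n < b)
    (hl : ∀ n ∈ l, n < b ∨ n = ⊤) (hF : ∀ s (h' : WithTop ℕ), h' ≠ b → F s h' = 0) :
    eastRow x y (p ++ (b : WithTop ℕ) :: l) ⊤ F = F (p ++ ⊤ :: l) b := by
  have hbl : (b : WithTop ℕ) ∉ l := fun hm => by simpa using hl _ hm
  induction p generalizing y F with
  | nil =>
    have hz : eastRow x (fun k => y (k + 1)) l ⊤ (fun s => F (b :: s)) = 0 :=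
      eastRow_eq_zero _ _ b _ _ _ hbl (by simp) fun s h' => hF _ _
    simp only [List.nil_append, eastRow, WithTop.natCast_ne_top, and_false, if_false, true_or,
      if_true, hz, ite_self, zero_add]
    exact eastRow_of_max _ _ _ _ _ hl fun s h' => hF _ _
  | cons n p ih =>
    simp only [List.mem_cons, forall_eq_or_imp] at hp
    have hn : n ≠ ⊤ := (lt_of_lt_of_le hp.1 le_top).ne
    have hz : eastRow x (fun k => y (k + 1)) (p ++ (b : WithTop ℕ) :: l) n (fun s => F (⊤ :: s)) = 0 :=
      eastRow_eq_zero_of_prefix _ _ b _ _ _ _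
        (fun a ha => (lt_of_lt_of_le (hp.2 a ha) le_top).ne) hbl hp.1.ne hn fun s h' => hF _ _
    simp only [List.cons_append, eastRow, hn, and_false, if_false, true_or, if_true, hz, add_zero,
      Ne.lt_top hn, or_true]
    exact ih _ _ hp.2 fun s h' => hF _ _

theorem eastRow_replicate_top (x : R) (y : ℕ → R) (p : ℕ) (l : List (WithTop ℕ))
    (F : List (WithTop ℕ) → WithTop ℕ → R) :
    eastRow x y (List.replicate p ⊤ ++ l) ⊤ F = (∏ j ∈ range p, (x - y j)) *
      eastRow x (fun k => y (k + p)) l ⊤ (fun s => F (List.replicate p ⊤ ++ s)) := by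
  induction p generalizing y F with
  | zero => simp
  | succ p ih =>
    simp only [List.replicate_succ, List.cons_append, eastRow, and_self, if_true, ih,
      prod_range_succ']
    rw [show (fun k => y (k + p + 1)) = fun k => y (k + (p + 1)) from rfl]
    ring

theorem westRow_replicate_top (x : R) (y : ℕ → R) (q : ℕ)
    (F : List (WithTop ℕ) → WithTop ℕ → R) :
    westRow x y (List.replicate q ⊤) F = F (List.replicate q ⊤) ⊤ := by
  induction q generalizing y F with
  | zero => rfl
  | succ q ih => simp [List.replicate_succ, westRow, ih]

/-- An elbow would leave on its West side a label greater than `a`, so the pipe `a` must go straight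
through every cell of `p`, gaining one factor in each. -/
theorem westRow_append (x : R) (y : ℕ → R) (a : ℕ) (p l : List (WithTop ℕ))
    (F : List (WithTop ℕ) → WithTop ℕ → R) (hp : ∀ n ∈ p, (a : WithTop ℕ) < n)
    (hF : ∀ s (h' : WithTop ℕ), h' ≠ a → F s h' = 0) :
    westRow x y (p ++ l) F = (∏ j ∈ range p.length, (x - y j)) *
      westRow x (fun k => y (k + p.length)) l (fun s => F (p ++ s)) := by
  induction p generalizing y F with
  | nil => simp
  | cons n p ih =>
    simp only [List.mem_cons, forall_eq_or_imp] at hp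
    have hc : (fun s h => F (h :: s) n + if h < n then (x - y 0) * F (n :: s) h else 0) =
        fun s h => (x - y 0) * F (n :: s) h := by
      funext s h
      rw [hF _ n hp.1.ne', zero_add]
      split_ifs with hlt
      · rfl
      · rw [hF _ h (by rintro rfl; exact hlt hp.1), mul_zero]
    simp only [List.cons_append, westRow, hc, westRow_mul, List.length_cons, prod_range_succ']
    rw [ih _ _ hp.2 fun s h' => hF _ _]
    rw [show (fun k => y (k + p.length + 1)) = fun k => y (k + (p.length + 1)) from rfl]
    ring

theorem westRow_cons_replicate_top (x : R) (y : ℕ → R) (a : ℕ) (q : ℕ)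
    (F : List (WithTop ℕ) → WithTop ℕ → R) :
    westRow x y ((a : WithTop ℕ) :: List.replicate q ⊤) F = F (⊤ :: List.replicate q ⊤) a := by
  simp [westRow, westRow_replicate_top]

theorem partitionFn_east_of_prefix (x y : ℕ → R) (b : ℕ) (rows : List (RowType × ℕ))
    (p l : List (WithTop ℕ)) (hp : ∀ n ∈ p, n < b) (hl : ∀ n ∈ l, n < b ∨ n = ⊤) :
    partitionFn x y ((.east, b) :: rows) (p ++ (b : WithTop ℕ) :: l) = partitionFn x y rows (p ++ ⊤ :: l) := by
  rw [partitionFn, eastRow_of_prefix _ _ _ _ _ _ hp hl]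
  · simp
  · intro s h' hh
    simp [hh]

/-! ### The value at the longest state -/

/-- The rows carry the labels `a, a + 1, …` in the order of the entries of their pipes. -/
def IsNumbered : ℕ → List (RowType × ℕ) → Prop
  | _, [] => True
  | a, (.west, b) :: rows => b = a ∧ IsNumbered (a + 1) rows
  | a, (.east, b) :: rows => b = a + rows.length ∧ IsNumbered a rows

/-- The labels `a + m - 1, …, a`. -/
def descList (a : ℕ) : ℕ → List (WithTop ℕ)
  | 0 => []
  | m + 1 => ((a + m : ℕ) : WithTop ℕ) :: descList a m

theorem descList_succ_eq_append (a m : ℕ) :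
    descList a (m + 1) = descList (a + 1) m ++ [(a : WithTop ℕ)] := by
  induction m with
  | zero => simp [descList]
  | succ m ih =>
    rw [descList, ih, descList, List.cons_append, show a + (m + 1) = a + 1 + m by omega]

theorem length_descList (a m : ℕ) : (descList a m).length = m := by
  induction m with
  | zero => rfl
  | succ m ih => simp [descList, ih]

theorem mem_descList {a m : ℕ} {n : WithTop ℕ} (h : n ∈ descList a m) :
    ∃ k, n = (k : ℕ) ∧ a ≤ k ∧ k < a + m := by
  induction m with
  | zero => simp [descList] at h
  | succ m ih =>
    simp only [descList, List.mem_cons] at h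
    rcases h with rfl | h
    · exact ⟨_, rfl, by omega, by omega⟩
    · obtain ⟨k, h1, h2, h3⟩ := ih h
      exact ⟨k, h1, h2, by omega⟩

/-- The filling is forced row by row. In a row of type `west` the smallest label runs straight below
the `p` empty columns and all larger labels, then turns up. In a row of type `east` the first `p`
cells are blank and the largest label turns up just after them. The removed label leaves an empty
column on the right or on the left, and this keeps the shape of the state. -/
theorem partitionFn_descList (x y : ℕ → R) (rows : List (RowType × ℕ)) (a p q : ℕ)
    (hr : IsNumbered a rows) :
    partitionFn x y rows
        (List.replicate p ⊤ ++ (descList a rows.length ++ List.replicate q ⊤)) =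
      ∏ k ∈ range rows.length, ∏ j ∈ range (p + (rows.length - 1 - k)), (x (a + k) - y j) := by
  induction rows generalizing a p q with
  | nil => simp [partitionFn, descList]
  | cons r rows ih =>
    rcases r with ⟨_ | _, b⟩
    · obtain ⟨rfl, hr⟩ := hr
      have h := ih (b + 1) p (q + 1) hr
      rw [partitionFn, List.length_cons, descList_succ_eq_append, List.append_assoc,
        ← List.append_assoc, westRow_append _ _ b]
      · rw [List.cons_append, List.nil_append, westRow_cons_replicate_top, if_pos rfl,
          ← List.replicate_succ, List.append_assoc, h, prod_range_succ', mul_comm]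
        congr 1
        · refine prod_congr rfl fun k hk => ?_
          rw [show b + 1 + k = b + (k + 1) by omega,
            show rows.length - 1 - k = rows.length + 1 - 1 - (k + 1) by omega]
        · simp [length_descList]
      · intro n hn
        simp only [List.mem_append, List.mem_replicate] at hn
        rcases hn with ⟨-, rfl⟩ | hn
        · simp
        · obtain ⟨k, rfl, hk, -⟩ := mem_descList hn
          exact_mod_cast hk
      · intro s h' hh
        simp [hh]
    · obtain ⟨rfl, hr⟩ := hr
      have h := ih a (p + 1) q hr
      rw [partitionFn, List.length_cons, descList, eastRow_replicate_top, List.cons_append]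
      have hE := eastRow_of_prefix (x (a + rows.length)) (fun k => y (k + p)) (a + rows.length) []
        (descList a rows.length ++ List.replicate q ⊤)
        (fun s h => if h = ((a + rows.length : ℕ) : WithTop ℕ) then
          partitionFn x y rows (List.replicate p ⊤ ++ s) else 0) (by simp) ?_ ?_
      · rw [List.nil_append] at hE
        rw [hE, if_pos rfl, List.nil_append,
          show List.replicate p (⊤ : WithTop ℕ) ++ ⊤ :: (descList a rows.length ++
            List.replicate q ⊤) = List.replicate (p + 1) ⊤ ++ (descList a rows.length ++
            List.replicate q ⊤) by simp [List.replicate_succ'], h, prod_range_succ, mul_comm]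
        congr 1
        · refine prod_congr rfl fun k hk => ?_
          have := mem_range.1 hk
          rw [show p + 1 + (rows.length - 1 - k) = p + (rows.length + 1 - 1 - k) by omega]
        · simp
      · intro n hn
        simp only [List.mem_append, List.mem_replicate] at hn
        rcases hn with hn | ⟨-, rfl⟩
        · obtain ⟨k, rfl, -, hk⟩ := mem_descList hn
          left
          exact_mod_cast hk
        · simp
      · intro s h' hh
        exact if_neg hh

end Lattice

end HybridPipeDream

/-! ### Double Schubert polynomials through exchange relations in the `y` variables -/

namespace DoubleSchubert

open MvPolynomial

theorem swap_consecutive_lt_iff {n : ℕ} {k k' : Fin n} (hk : k'.val = k.val + 1) {a b : Fin n}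
    (h1 : ¬ (a = k ∧ b = k')) (h2 : ¬ (a = k' ∧ b = k)) :
    Equiv.swap k k' a < Equiv.swap k k' b ↔ a < b := by
  simp only [Equiv.swap_apply_def, Fin.ext_iff, Fin.lt_def] at *
  split_ifs <;> omega

/-- Without ascents, `w` followed by `Fin.rev` is strictly increasing, and the identity is the only
order automorphism of `Fin n`. -/
theorem eq_revPerm_of_no_ascent {n : ℕ} {w : Equiv.Perm (Fin n)} (h : ¬ ∃ p, IsAscent w p) :
    w = Fin.revPerm := by
  have hs : StrictMono fun a => Fin.rev (w a) := by
    rcases n with _ | n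
    · exact fun a => a.elim0
    · refine Fin.strictMono_iff_lt_succ.2 fun i => ?_
      rw [Fin.rev_lt_rev]
      refine lt_of_le_of_ne (not_lt.1 fun hlt => h ⟨(i.castSucc, i.succ), by simp, hlt⟩) ?_
      exact fun he => by simpa [Fin.ext_iff] using w.injective he
  have hid : ∀ a, Fin.rev (w a) = a := by
    have : (fun a => Fin.rev (w a)) = id := by
      have := Subsingleton.elim (hs.orderIsoOfSurjective _
        (Fin.rev_surjective.comp w.surjective)) (OrderIso.refl (Fin n))
      funext a
      exact DFunLike.congr_fun this a
    exact fun a => congrFun this a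
  refine Equiv.ext fun a => ?_
  rw [Fin.revPerm_apply, ← Fin.rev_rev (w a), hid]

/-- Exchange of the variables `y i` and `y j`. -/
noncomputable def swapY {n : ℕ} (i j : Fin n) (f : MvPolynomial (Fin n ⊕ Fin n) ℤ) :
    MvPolynomial (Fin n ⊕ Fin n) ℤ :=
  rename (Sum.map id (Equiv.swap i j)) f

theorem swapX_swapY_comm {n : ℕ} (i i' j j' : Fin n) (f : MvPolynomial (Fin n ⊕ Fin n) ℤ) :
    swapX i i' (swapY j j' f) = swapY j j' (swapX i i' f) := by
  simp [swapX, swapY, rename_rename, Sum.map_comp_map]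

theorem X_inl_sub_ne_zero {n : ℕ} {i j : Fin n} (h : i ≠ j) :
    (X (Sum.inl i) - X (Sum.inl j) : MvPolynomial (Fin n ⊕ Fin n) ℤ) ≠ 0 := by
  rw [sub_ne_zero]
  exact fun he => h (Sum.inl_injective (X_injective he))

theorem X_inr_sub_ne_zero {n : ℕ} {i j : Fin n} (h : i ≠ j) :
    (X (Sum.inr i) - X (Sum.inr j) : MvPolynomial (Fin n ⊕ Fin n) ℤ) ≠ 0 := by
  rw [sub_ne_zero]
  exact fun he => h (Sum.inr_injective (X_injective he))

/-- The double Schubert polynomial of the longest permutation. -/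
noncomputable def longestProd (n : ℕ) : MvPolynomial (Fin n ⊕ Fin n) ℤ :=
  ∏ p ∈ (univ : Finset (Fin n × Fin n)).filter (fun p => p.1.val + p.2.val + 2 ≤ n),
    (X (Sum.inl p.1) - X (Sum.inr p.2))

/-- The position `(i, j)` is an outer corner of the staircase. Once it is removed, rows `i`, `i'`
have equal length, and so have columns `j`, `j'`. -/
theorem longestProd_factor {n : ℕ} {i i' j j' : Fin n} (hi : i'.val = i.val + 1)
    (hj : j'.val = j.val + 1) (hij : i.val + j.val + 2 = n) :
    ∃ G, longestProd n = (X (Sum.inl i) - X (Sum.inr j)) * G ∧ swapX i i' G = G ∧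
      swapY j j' G = G := by
  have hm : (i, j) ∈ (univ : Finset (Fin n × Fin n)).filter
      (fun p => p.1.val + p.2.val + 2 ≤ n) := by
    rw [mem_filter]
    exact ⟨mem_univ _, hij.le⟩
  refine ⟨_, (mul_prod_erase _ _ hm).symm, ?_, ?_⟩
  · simp only [swapX, map_prod, map_sub, rename_X, Sum.map_inl, Sum.map_inr, id]
    refine prod_equiv ((Equiv.swap i i').prodCongr (Equiv.refl _)) ?_ fun _ _ => rfl
    rintro ⟨a, b⟩
    simp only [mem_erase, mem_filter, mem_univ, true_and, Equiv.prodCongr_apply, Prod.map,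
      Equiv.refl_apply, Equiv.swap_apply_def, Prod.mk.injEq, ne_eq, Fin.ext_iff]
    split_ifs <;> omega
  · simp only [swapY, map_prod, map_sub, rename_X, Sum.map_inl, Sum.map_inr, id]
    refine prod_equiv ((Equiv.refl _).prodCongr (Equiv.swap j j')) ?_ fun _ _ => rfl
    rintro ⟨a, b⟩
    simp only [mem_erase, mem_filter, mem_univ, true_and, Equiv.prodCongr_apply, Prod.map,
      Equiv.refl_apply, Equiv.swap_apply_def, Prod.mk.injEq, ne_eq, Fin.ext_iff]
    split_ifs <;> omega

theorem revPerm_mul_swap {n : ℕ} (i j : Fin n) :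
    Fin.revPerm * Equiv.swap i j = Equiv.swap (Fin.rev j) (Fin.rev i) * Fin.revPerm := by
  rw [Equiv.swap_comm (Fin.rev j)]
  exact Equiv.mul_swap_eq_swap_mul _ _ _

section Characterisation

variable {n : ℕ} {F : Equiv.Perm (Fin n) → MvPolynomial (Fin n ⊕ Fin n) ℤ}

/-- A family of polynomials with the exchange relations of the `y` variables and the right value
at the longest permutation has the exchange relations of the `x` variables. -/
theorem sub_swapX_of_swapY (h0 : F Fin.revPerm = longestProd n)
    (hy : ∀ (w : Equiv.Perm (Fin n)) (j j' : Fin n), j'.val = j.val + 1 → swapY j j' (F w) = F w +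
      if w⁻¹ j' < w⁻¹ j then (X (Sum.inr j) - X (Sum.inr j')) * F (Equiv.swap j j' * w) else 0)
    (w : Equiv.Perm (Fin n)) (i i' : Fin n) (hi : i'.val = i.val + 1) :
    F w - swapX i i' (F w) =
      if w i' < w i then (X (Sum.inl i) - X (Sum.inl i')) * F (w * Equiv.swap i i') else 0 := by
  -- Passing from `w` to `v = s_j w` at an ascent of `w⁻¹` lowers this sum, and the induction ends
  -- at the longest permutation.
  induction hμ : ∑ a, a.val * (w⁻¹ a).val using Nat.strong_induction_on generalizing w with
  | _ μ ih =>
  have hii : i ≠ i' := fun e => by rw [e] at hi; omega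
  by_cases hw : ∃ p, IsAscent w⁻¹ p
  · obtain ⟨⟨j, j'⟩, hj, hlt⟩ := hw
    simp only at hj hlt
    have hjj : j ≠ j' := fun e => by rw [e] at hj; omega
    set v := Equiv.swap j j' * w with hv
    have hvw : Equiv.swap j j' * v = w := by rw [hv, Equiv.swap_mul_self_mul]
    have hvinv : v⁻¹ = w⁻¹ * Equiv.swap j j' := by rw [hv, mul_inv_rev, Equiv.swap_inv]
    have hm := IsAscent.measure_lt (w := w⁻¹) (p := (j, j')) ⟨hj, hlt⟩
    rw [← hvinv, hμ] at hm
    have hIH := ih _ hm v rfl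
    have hyv := hy v j j' hj
    rw [hvw, hvinv, Equiv.Perm.mul_apply, Equiv.Perm.mul_apply, Equiv.swap_apply_left,
      Equiv.swap_apply_right, if_pos hlt] at hyv
    have hyvs := hy (v * Equiv.swap i i') j j' hj
    rw [← mul_assoc, hvw, mul_inv_rev, Equiv.swap_inv, hvinv] at hyvs
    simp only [Equiv.Perm.mul_apply, Equiv.swap_apply_left, Equiv.swap_apply_right] at hyvs
    have hXY : swapY j j' (X (Sum.inl i) - X (Sum.inl i') : MvPolynomial (Fin n ⊕ Fin n) ℤ) =
        X (Sum.inl i) - X (Sum.inl i') := by simp [swapY]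
    have hYX : swapX i i' (X (Sum.inr j) - X (Sum.inr j') : MvPolynomial (Fin n ⊕ Fin n) ℤ) =
        X (Sum.inr j) - X (Sum.inr j') := by simp [swapX]
    have hadd : ∀ f g : MvPolynomial (Fin n ⊕ Fin n) ℤ,
        swapX i i' (f + g) = swapX i i' f + swapX i i' g := fun f g => map_add _ _ _
    have hmul : ∀ f g : MvPolynomial (Fin n ⊕ Fin n) ℤ,
        swapX i i' (f * g) = swapX i i' f * swapX i i' g := fun f g => map_mul _ _ _
    have hsubY : ∀ f g : MvPolynomial (Fin n ⊕ Fin n) ℤ,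
        swapY j j' (f - g) = swapY j j' f - swapY j j' g := fun f g => map_sub _ _ _
    have hmulY : ∀ f g : MvPolynomial (Fin n ⊕ Fin n) ℤ,
        swapY j j' (f * g) = swapY j j' f * swapY j j' g := fun f g => map_mul _ _ _
    -- By the relation at `v`, `F w` times `y j - y j'` is the change of `F v` under the exchange of
    -- these variables. That exchange commutes with the one in `x`, so the relation in `x` passes
    -- from `v` to `w`.
    refine mul_left_cancel₀ (X_inr_sub_ne_zero hjj) ?_
    have e1 : (X (Sum.inr j) - X (Sum.inr j')) * (F w - swapX i i' (F w)) =
        swapY j j' (F v - swapX i i' (F v)) - (F v - swapX i i' (F v)) := by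
      rw [hsubY, ← swapX_swapY_comm, hyv, hadd, hmul, hYX]
      ring
    -- A descent of `w` at `i` must correspond to both relations used being nontrivial. The special
    -- case is `w i = j`, `w i' = j'`, where `v * s_i = w` and both sides are false.
    have hc : (w i' < w i) ↔
        (v i' < v i ∧ Equiv.swap i i' (w⁻¹ j) < Equiv.swap i i' (w⁻¹ j')) := by
      by_cases hs : w⁻¹ j = i ∧ w⁻¹ j' = i'
      · have h1 : w i = j := by rw [← hs.1]; simp
        have h2 : w i' = j' := by rw [← hs.2]; simp
        rw [hs.1, hs.2, h1, h2, Equiv.swap_apply_left, Equiv.swap_apply_right]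
        simp only [Fin.lt_def]
        omega
      · have hs' : ¬ (w⁻¹ j = i' ∧ w⁻¹ j' = i) := by
          rintro ⟨h1, h2⟩
          rw [h1, h2, Fin.lt_def] at hlt
          omega
        rw [swap_consecutive_lt_iff hi hs hs', hv, Equiv.Perm.mul_apply, Equiv.Perm.mul_apply,
          swap_consecutive_lt_iff hj, and_iff_left hlt]
        · rintro ⟨h1, h2⟩
          exact hs' ⟨by simp [← h1], by simp [← h2]⟩
        · rintro ⟨h1, h2⟩
          exact hs ⟨by simp [← h2], by simp [← h1]⟩
    rw [e1, hIH]
    by_cases h1 : v i' < v i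
    · rw [if_pos h1, hmulY, hXY, hyvs]
      by_cases h2 : Equiv.swap i i' (w⁻¹ j) < Equiv.swap i i' (w⁻¹ j')
      · rw [if_pos h2, if_pos (hc.2 ⟨h1, h2⟩)]
        ring
      · rw [if_neg h2, if_neg (fun h => h2 (hc.1 h).2)]
        ring
    · rw [if_neg h1, if_neg (fun h => h1 (hc.1 h).1)]
      simp [swapY]
  · have hw' : w = Fin.revPerm := by
      rw [← inv_inv w, eq_revPerm_of_no_ascent hw]
      rfl
    subst hw'
    have hlt : (Fin.revPerm i' : Fin n) < Fin.revPerm i := by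
      rw [Fin.revPerm_apply, Fin.revPerm_apply, Fin.rev_lt_rev, Fin.lt_def]
      omega
    have hj : (Fin.rev i).val = (Fin.rev i').val + 1 := by
      simp only [Fin.val_rev]
      omega
    -- For the corner in row `i`, both difference quotients, in `x` and (up to sign) in `y`, equal
    -- `G`. They also concern the same permutation, by `revPerm_mul_swap`.
    obtain ⟨G, hG, hGX, hGY⟩ := longestProd_factor hi hj (by
      simp only [Fin.val_rev]
      omega)
    have hlt' : i < i' := by
      rw [Fin.lt_def]
      omega
    have hyw := hy Fin.revPerm _ _ hj
    have hrev : (Fin.revPerm⁻¹ : Equiv.Perm (Fin n)) = Fin.revPerm := rfl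
    rw [hrev, Fin.revPerm_apply, Fin.revPerm_apply, Fin.rev_rev, Fin.rev_rev, if_pos hlt', ← revPerm_mul_swap] at hyw
    rw [if_pos hlt]
    have hjj : Fin.rev i' ≠ Fin.rev i := fun e => hii (Fin.rev_injective e).symm
    refine mul_left_cancel₀ (X_inr_sub_ne_zero hjj) ?_
    rw [mul_left_comm, ← sub_eq_iff_eq_add'.2 hyw, h0, hG]
    have e1 : swapX i i' ((X (Sum.inl i) - X (Sum.inr (Fin.rev i'))) * G) =
        (X (Sum.inl i') - X (Sum.inr (Fin.rev i'))) * swapX i i' G := by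
      simp [swapX]
    have e2 : swapY (Fin.rev i') (Fin.rev i) ((X (Sum.inl i) - X (Sum.inr (Fin.rev i'))) * G) =
        (X (Sum.inl i) - X (Sum.inr (Fin.rev i))) * swapY (Fin.rev i') (Fin.rev i) G := by
      simp [swapY]
    rw [e1, e2, hGX, hGY]
    ring

/-- The definition of `doubleSchubert` picks some ascent. The relation in `x` is available at every
ascent, so the choice does not matter. -/
theorem doubleSchubert_eq_of_swapY (h0 : F Fin.revPerm = longestProd n)
    (hy : ∀ (w : Equiv.Perm (Fin n)) (j j' : Fin n), j'.val = j.val + 1 → swapY j j' (F w) = F w +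
      if w⁻¹ j' < w⁻¹ j then (X (Sum.inr j) - X (Sum.inr j')) * F (Equiv.swap j j' * w) else 0)
    (w : Equiv.Perm (Fin n)) : doubleSchubert w = F w := by
  induction hμ : ∑ a, a.val * (w a).val using Nat.strong_induction_on generalizing w with
  | _ μ ih =>
  rw [doubleSchubert]
  split_ifs with h
  · have hp := h.choose_spec
    set p := h.choose
    have hm := hp.measure_lt
    rw [hμ] at hm
    rw [ih _ hm _ rfl]
    have hne : p.1 ≠ p.2 := fun e => by
      have := hp.1
      rw [e] at this
      omega
    refine mul_left_cancel₀ (X_inl_sub_ne_zero hne) ?_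
    have hs := (sub_dvd_sub_swapX p.1 p.2 (F (w * Equiv.swap p.1 p.2))).choose_spec
    rw [dividedDifference, ← hs, sub_swapX_of_swapY h0 hy _ _ _ hp.1, mul_assoc,
      Equiv.swap_mul_self, mul_one, if_pos]
    simpa using hp.2
  · rw [eq_revPerm_of_no_ascent h, h0, longestProd]

end Characterisation

end DoubleSchubert

/-! ### The partition function of a permutation and of a minimal extension -/

namespace HybridPipeDream

section Lattice

variable {R S : Type*} [CommRing R] [CommRing S]

theorem map_westRow (φ : R →+* S) (x : R) (y : ℕ → R) (l : List (WithTop ℕ))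
    (F : List (WithTop ℕ) → WithTop ℕ → R) :
    φ (westRow x y l F) = westRow (φ x) (fun k => φ (y k)) l (fun s h => φ (F s h)) := by
  induction l generalizing y F with
  | nil => rfl
  | cons n l ih =>
    simp only [westRow, ih]
    congr 1
    funext s h
    split_ifs <;> simp

theorem map_eastRow (φ : R →+* S) (x : R) (y : ℕ → R) (l : List (WithTop ℕ)) (h : WithTop ℕ)
    (F : List (WithTop ℕ) → WithTop ℕ → R) :
    φ (eastRow x y l h F) = eastRow (φ x) (fun k => φ (y k)) l h (fun s h => φ (F s h)) := by
  induction l generalizing y F h with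
  | nil => rfl
  | cons n l ih =>
    simp only [eastRow, ← ih]
    split_ifs <;> simp

/-- It turns an exchange of the variables `y` in the polynomial into an exchange in the sequence of
parameters. -/
theorem map_partitionFn (φ : R →+* S) (x y : ℕ → R) (rows : List (RowType × ℕ))
    (l : List (WithTop ℕ)) :
    φ (partitionFn x y rows l) = partitionFn (fun k => φ (x k)) (fun k => φ (y k)) rows l := by
  induction rows generalizing l with
  | nil => simp only [partitionFn]; split_ifs <;> simp
  | cons r rows ih =>
    rcases r with ⟨_ | _, a⟩
    · simp only [partitionFn, map_westRow, ← ih]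
      congr 1
      funext s h
      split_ifs <;> simp
    · simp only [partitionFn, map_eastRow, ← ih]
      congr 1
      funext s h
      split_ifs <;> simp

end Lattice

/-- The state in which the pipe with label `i < k` is in column `w i`. -/
def permState {n : ℕ} (w : Equiv.Perm (Fin n)) (k : ℕ) (c : Fin n) : WithTop ℕ :=
  if (w⁻¹ c).val < k then ((w⁻¹ c).val : WithTop ℕ) else ⊤

/-- Rows of type `east` with labels `m + d - 1, …, m` on top of the given rows. -/
def addEastRows (m : ℕ) (rows : List (RowType × ℕ)) : ℕ → List (RowType × ℕ)
  | 0 => rows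
  | d + 1 => (.east, m + d) :: addEastRows m rows d

theorem length_addEastRows (rows : List (RowType × ℕ)) (d : ℕ) :
    (addEastRows rows.length rows d).length = rows.length + d := by
  induction d with
  | zero => rfl
  | succ d ih => simp [addEastRows, ih, add_assoc]

theorem isNumbered_addEastRows {rows : List (RowType × ℕ)} (h : IsNumbered 0 rows) (d : ℕ) :
    IsNumbered 0 (addEastRows rows.length rows d) := by
  induction d with
  | zero => exact h
  | succ d ih => exact ⟨by rw [length_addEastRows, zero_add], ih⟩

section

variable {R : Type*} [CommRing R]

/-- The label `b` is the largest one present, and since later values of `w` exceed `w b`, every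
empty column lies to the right of column `w b`. This is the situation of a forced row of weight `1`.
-/
theorem partitionFn_east_permState (x y : ℕ → R) {n : ℕ} (w : Equiv.Perm (Fin n)) (b : Fin n)
    (hw : ∀ a, b < a → w b < w a) (rows : List (RowType × ℕ)) :
    partitionFn x y ((.east, b.val) :: rows) (List.ofFn (permState w (b + 1))) =
      partitionFn x y rows (List.ofFn (permState w b)) := by
  set l := List.ofFn (permState w (b + 1)) with hl
  have hlen : l.length = n := by simp [hl]
  have hget : ∀ k (hk : k < l.length), l[k] = permState w (b + 1) ⟨k, hlen ▸ hk⟩ := by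
    intro k hk
    simp [hl]
  have hc : (w b).val < l.length := by rw [hlen]; exact (w b).isLt
  have hb : l[(w b).val] = ((b : ℕ) : WithTop ℕ) := by
    rw [hget]
    simp [permState]
  have h1 : l = l.take (w b).val ++ ((b : ℕ) : WithTop ℕ) :: l.drop ((w b).val + 1) := by
    have := List.set_getElem_self hc
    rw [List.set_eq_take_append_cons_drop, if_pos hc, hb] at this
    exact this.symm
  have h2 : List.ofFn (permState w b) = l.take (w b).val ++ ⊤ :: l.drop ((w b).val + 1) := by
    have : List.ofFn (permState w b) = l.set (w b).val ⊤ := by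
      refine List.ext_getElem (by simp [hl]) fun k hk hk' => ?_
      have hkn : k < n := by simpa using hk
      rw [List.getElem_set, hget, List.getElem_ofFn]
      split_ifs with he
      · have : (⟨k, hkn⟩ : Fin n) = w b := Fin.ext he.symm
        simp [permState, this]
      · have : (w⁻¹ ⟨k, hkn⟩).val ≠ b.val := by
          intro h
          apply he
          rw [← Fin.ext h]
          simp
        simp only [permState]
        split_ifs <;> first | rfl | omega
    rw [this, List.set_eq_take_append_cons_drop, if_pos hc]
  have hval : ∀ k (hk : k < l.length), k ≠ (w b).val → l[k] < ((b : ℕ) : WithTop ℕ) ∨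
      l[k] = ⊤ ∧ (w b).val < k := by
    intro k hk hne
    rw [hget, permState]
    have hne' : (w⁻¹ ⟨k, hlen ▸ hk⟩).val ≠ b.val := by
      intro h
      apply hne
      rw [← Fin.ext h]
      simp
    split_ifs with hlt
    · left
      have : (w⁻¹ ⟨k, hlen ▸ hk⟩).val < b.val := by omega
      exact_mod_cast this
    · refine Or.inr ⟨rfl, ?_⟩
      have h3 : b < w⁻¹ ⟨k, hlen ▸ hk⟩ := by
        rw [Fin.lt_def]
        omega
      simpa [Fin.lt_def] using hw _ h3
  rw [h2]
  conv_lhs => rw [h1]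
  refine partitionFn_east_of_prefix _ _ _ _ _ _ ?_ ?_
  · intro a ha
    obtain ⟨k, hk, rfl⟩ := List.mem_iff_getElem.1 ha
    rw [List.length_take] at hk
    rw [List.getElem_take]
    rcases hval k (by omega) (by omega) with h | h
    · exact h
    · omega
  · intro a ha
    obtain ⟨k, hk, rfl⟩ := List.mem_iff_getElem.1 ha
    rw [List.length_drop] at hk
    rw [List.getElem_drop]
    rcases hval ((w b).val + 1 + k) (by omega) (by omega) with h | h
    · exact Or.inl h
    · exact Or.inr h.1

theorem partitionFn_addEastRows (x y : ℕ → R) {n : ℕ} (w : Equiv.Perm (Fin n))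
    (rows : List (RowType × ℕ)) (hw : ∀ a b : Fin n, rows.length ≤ a.val → a < b → w a < w b)
    (d : ℕ) (hd : rows.length + d ≤ n) :
    partitionFn x y (addEastRows rows.length rows d)
        (List.ofFn (permState w (rows.length + d))) =
      partitionFn x y rows (List.ofFn (permState w rows.length)) := by
  induction d with
  | zero => rfl
  | succ d ih =>
    rw [← ih (by omega)]
    exact partitionFn_east_permState x y w ⟨rows.length + d, by omega⟩
      (fun a ha => hw _ a (by simp) ha) _

end

open MvPolynomial

/-- The variables `x`, as a sequence. -/
noncomputable def xSeq (n k : ℕ) : MvPolynomial (Fin n ⊕ Fin n) ℤ :=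
  if h : k < n then X (Sum.inl ⟨k, h⟩) else 0

/-- The variables `y`, as a sequence. -/
noncomputable def ySeq (n k : ℕ) : MvPolynomial (Fin n ⊕ Fin n) ℤ :=
  if h : k < n then X (Sum.inr ⟨k, h⟩) else 0

theorem ofFn_permState_revPerm (n : ℕ) :
    List.ofFn (permState (Fin.revPerm : Equiv.Perm (Fin n)) n) = descList 0 n := by
  have hget : ∀ m k (hk : k < (descList 0 m).length),
      (descList 0 m)[k] = ((m - 1 - k : ℕ) : WithTop ℕ) := by
    intro m
    induction m with
    | zero => intro k hk; simp [descList] at hk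
    | succ m ih =>
      intro k hk
      rcases k with _ | k
      · simp [descList]
      · simp only [descList, List.getElem_cons_succ, ih]
        congr 1
        omega
  refine List.ext_getElem (by simp [length_descList]) fun k hk hk' => ?_
  rw [List.getElem_ofFn, hget, permState, if_pos (Fin.isLt _)]
  have hrev : (Fin.revPerm⁻¹ : Equiv.Perm (Fin n)) = Fin.revPerm := rfl
  rw [hrev, Fin.revPerm_apply, Fin.val_rev]
  congr 1
  simp only
  omega

theorem prod_range_eq_longestProd (n : ℕ) :
    ∏ k ∈ range n, ∏ j ∈ range (n - 1 - k), (xSeq n k - ySeq n j) =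
      DoubleSchubert.longestProd n := by
  rw [DoubleSchubert.longestProd, prod_filter, ← univ_product_univ, prod_product,
    ← Fin.prod_univ_eq_prod_range (fun k => ∏ j ∈ range (n - 1 - k), (xSeq n k - ySeq n j))]
  refine prod_congr rfl fun k _ => ?_
  have h1 : ∀ j : Fin n, (if k.val + j.val + 2 ≤ n then
      (X (Sum.inl k) - X (Sum.inr j) : MvPolynomial (Fin n ⊕ Fin n) ℤ) else 1) =
      (fun j : ℕ => if k.val + j + 2 ≤ n then xSeq n k - ySeq n j else 1) j := by
    intro j
    simp [xSeq, ySeq]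
  simp only [h1]
  rw [Fin.prod_univ_eq_prod_range (fun j : ℕ =>
    if k.val + j + 2 ≤ n then xSeq n k - ySeq n j else 1) n, ← prod_filter]
  refine prod_congr ?_ fun _ _ => rfl
  ext j
  simp only [mem_range, mem_filter]
  omega

theorem swapY_ySeq {n : ℕ} (j j' : Fin n) (hj : j'.val = j.val + 1) (k : ℕ) :
    DoubleSchubert.swapY j j' (ySeq n k) = swapSeq (ySeq n) j k := by
  rw [ySeq, swapSeq]
  by_cases hk : k < n
  · have h1 : Equiv.swap j.val (j.val + 1) k = (Equiv.swap j j' ⟨k, hk⟩).val := by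
      have h2 : (⟨k, hk⟩ : Fin n).val = k := rfl
      simp only [Equiv.swap_apply_def, Fin.ext_iff]
      split_ifs <;> omega
    rw [dif_pos hk, h1, ySeq, dif_pos (Fin.isLt _)]
    simp [DoubleSchubert.swapY]
  · rw [dif_neg hk, Equiv.swap_apply_of_ne_of_ne (by omega) (by omega), ySeq, dif_neg hk]
    simp [DoubleSchubert.swapY]

theorem swapY_xSeq {n : ℕ} (j j' : Fin n) (k : ℕ) :
    DoubleSchubert.swapY j j' (xSeq n k) = xSeq n k := by
  rw [xSeq]
  split_ifs <;> simp [DoubleSchubert.swapY]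

/-- For a permutation the partition function is the double Schubert polynomial, whatever the types
of the rows. -/
theorem partitionFn_permState_eq_doubleSchubert {n : ℕ} (rows : List (RowType × ℕ))
    (hlen : rows.length = n) (hr : IsNumbered 0 rows) (w : Equiv.Perm (Fin n)) :
    partitionFn (xSeq n) (ySeq n) rows (List.ofFn (permState w n)) =
      DoubleSchubert.doubleSchubert w := by
  symm
  refine DoubleSchubert.doubleSchubert_eq_of_swapY
    (F := fun w => partitionFn (xSeq n) (ySeq n) rows (List.ofFn (permState w n))) ?_ ?_ w
  · have h := partitionFn_descList (xSeq n) (ySeq n) rows 0 0 0 hr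
    simp only [List.replicate_zero, List.nil_append, List.append_nil, hlen, zero_add] at h
    simp only [ofFn_permState_revPerm, h, prod_range_eq_longestProd]
  · intro w j j' hj
    have h1 := map_partitionFn (rename (Sum.map id (Equiv.swap j j')) :
      MvPolynomial (Fin n ⊕ Fin n) ℤ →ₐ[ℤ] _).toRingHom (xSeq n) (ySeq n) rows
      (List.ofFn (permState w n))
    have h2 : (fun k => (rename (Sum.map id (Equiv.swap j j')) :
      MvPolynomial (Fin n ⊕ Fin n) ℤ →ₐ[ℤ] _).toRingHom (ySeq n k)) = swapSeq (ySeq n) j :=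
      funext fun k => swapY_ySeq j j' hj k
    have h3 : (fun k => (rename (Sum.map id (Equiv.swap j j')) :
      MvPolynomial (Fin n ⊕ Fin n) ℤ →ₐ[ℤ] _).toRingHom (xSeq n k)) = xSeq n :=
      funext fun k => swapY_xSeq j j' k
    have hjn : j.val + 1 < n := by omega
    have hj' : j' = ⟨j.val + 1, hjn⟩ := Fin.ext hj
    rw [h2, h3, partitionFn_swapSeq _ _ _ _ _ (by simpa using hjn), adjOp_ofFn _ _ hjn] at h1
    refine h1.trans ?_
    have hlt : permState w n ⟨j.val + 1, hjn⟩ < permState w n ⟨j.val, j.isLt⟩ ↔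
        w⁻¹ j' < w⁻¹ j := by
      rw [← hj']
      simp [permState]
    have hX : ySeq n j - ySeq n (j + 1) = X (Sum.inr j) - X (Sum.inr j') := by
      rw [ySeq, ySeq, dif_pos j.isLt, dif_pos hjn, hj']
    have hstate : (fun k => permState w n (Equiv.swap ⟨j.val, j.isLt⟩ ⟨j.val + 1, hjn⟩ k)) =
        permState (Equiv.swap j j' * w) n := by
      funext k
      rw [← hj']
      simp only [permState, mul_inv_rev, Equiv.swap_inv, Equiv.Perm.mul_apply]
    simp only [hlt, hX, hstate]

theorem minimalExtension_apply_lt {m n : ℕ} (hmn : m ≤ n) (π : Fin m ↪ Fin n) (k : Fin m) :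
    minimalExtension π (Fin.castLE hmn k) = π k := by
  simp [minimalExtension, minimalExtensionFun]

theorem minimalExtension_lt {m n : ℕ} (π : Fin m ↪ Fin n) (a b : Fin n) (ha : m ≤ a.val)
    (hab : a < b) : minimalExtension π a < minimalExtension π b := by
  rw [Fin.lt_def] at hab
  simp only [minimalExtension, Equiv.ofBijective_apply, minimalExtensionFun]
  rw [dif_neg (by omega), dif_neg (by omega)]
  refine (OrderEmbedding.lt_iff_lt _).2 ?_
  rw [Fin.lt_def]
  simp only
  omega

/-- The columns outside the image of `π` are filled in increasing order, which is what the added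
rows of type `east` need in order to be forced. -/
theorem partitionFn_minimalExtension {m n : ℕ} (hmn : m ≤ n) (π : Fin m ↪ Fin n)
    (rows : List (RowType × ℕ)) (hlen : rows.length = m) (hr : IsNumbered 0 rows) :
    partitionFn (xSeq n) (ySeq n) rows (List.ofFn (permState (minimalExtension π) m)) =
      DoubleSchubert.doubleSchubert (minimalExtension π) := by
  subst hlen
  obtain ⟨d, rfl⟩ := Nat.exists_eq_add_of_le hmn
  rw [← partitionFn_addEastRows _ _ (minimalExtension π) rows (minimalExtension_lt π) d le_rfl]
  exact partitionFn_permState_eq_doubleSchubert _ (length_addEastRows rows d)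
    (isNumbered_addEastRows hr d) _

end HybridPipeDream

namespace HybridPipeDream

/-! ### Labelled tiles -/

/-- The labels of the edges of a tile are compatible with its strands. -/
def Strands (t : Tile) (e : Side → WithTop ℕ) : Prop :=
  ∀ s, (t.other s = none → e s = ⊤) ∧ ∀ s', t.other s = some s' → e s ≠ ⊤ ∧ e s' = e s

/-- The pipes that cross in a tile of a row of the given type come in uncrossed. -/
def CrossOrder (b : RowType) (t : Tile) (e : Side → WithTop ℕ) : Prop :=
  t = .cross → match b with
    | .west => e .W < e .S
    | .east => e .S < e .E

/-- The labels of the sides of a tile. -/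
def sideLabels (W S N E : WithTop ℕ) : Side → WithTop ℕ
  | .W => W
  | .S => S
  | .N => N
  | .E => E

/-- The tile with the given labels on its sides may occur in a row of type `b`. -/
def CellOk (b : RowType) (t : Tile) (W S N E : WithTop ℕ) : Prop :=
  t.Allowed b ∧ Strands t (sideLabels W S N E) ∧ CrossOrder b t (sideLabels W S N E)

theorem Side.forall_iff {p : Side → Prop} : (∀ s, p s) ↔ p .N ∧ p .E ∧ p .S ∧ p .W :=
  ⟨fun h => ⟨h _, h _, h _, h _⟩, fun ⟨h1, h2, h3, h4⟩ s => by cases s <;> assumption⟩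

theorem sum_tile {M : Type*} [AddCommMonoid M] (f : Tile → M) :
    ∑ t, f t = f .blank + (f .horiz + (f .vert + (f .cross + (f .elbowWN + (f .elbowSE +
      (f .bumpWNSE + (f .elbowEN + (f .elbowSW + f .bumpENSW)))))))) := by
  have : (univ : Finset Tile) = {.blank, .horiz, .vert, .cross, .elbowWN, .elbowSE, .bumpWNSE,
    .elbowEN, .elbowSW, .bumpENSW} := rfl
  rw [this]
  simp

open Classical in
/-- The factor contributed by a tile in a row of type `b`. -/
noncomputable def cellWeight {R : Type*} [CommRing R] (b : RowType) (c : R) (t : Tile) : R :=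
  match b with
  | .west => if t.IsStraight then c else 1
  | .east => if t = .blank then c else 1

open Classical in
-- For each tile the labels on the North and East determine those on the South and West. Exactly one
-- tile is blank or made of elbows with the given labels, and at most one is straight.
theorem sum_west_cell {R : Type*} [CommRing R] (c : R) (n h : WithTop ℕ)
    (Q : WithTop ℕ → WithTop ℕ → Prop) :
    (∑ t, cellWeight .west c t * if ∃ s w, CellOk .west t w s n h ∧ Q s w then 1 else 0) =
      (if Q h n then 1 else 0) + if h < n then c * (if Q n h then 1 else 0) else 0 := by
  have hS : Tile.cross.IsStraight ∧ Tile.horiz.IsStraight ∧ ¬ Tile.blank.IsStraight ∧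
    ¬ Tile.elbowWN.IsStraight ∧ ¬ Tile.elbowSE.IsStraight ∧ ¬ Tile.bumpWNSE.IsStraight := by
    simp [Tile.IsStraight]
  induction n using WithTop.recTopCoe <;> induction h using WithTop.recTopCoe <;>
    simp [sum_tile, CellOk, Strands, CrossOrder, Side.forall_iff, Tile.other, Side.opp, sideLabels,
      Tile.Allowed, cellWeight, hS]
  all_goals (split_ifs <;> simp_all [add_comm])

open Classical in
-- Here the labels on the West and North are given. The different case distinction reflects the
-- exchange of the double elbow for the vertical tile.
theorem sum_east_cell {R : Type*} [CommRing R] (c : R) (n h : WithTop ℕ)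
    (Q : WithTop ℕ → WithTop ℕ → Prop) :
    (∑ t, cellWeight .east c t * if ∃ s e, CellOk .east t h s n e ∧ Q s e then 1 else 0) =
      if h = ⊤ ∧ n = ⊤ then c * (if Q ⊤ ⊤ then 1 else 0)
      else (if n = ⊤ ∨ n < h then (if Q n h then 1 else 0) else 0) +
        if h = ⊤ ∨ n = ⊤ then (if Q h n then 1 else 0) else 0 := by
  induction n using WithTop.recTopCoe <;> induction h using WithTop.recTopCoe <;>
    simp [sum_tile, CellOk, Strands, CrossOrder, Side.forall_iff, Tile.other, Side.opp, sideLabels,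
      Tile.Allowed, cellWeight]
  all_goals (split_ifs <;> simp_all [add_comm])

/-- The sequence `a, f 0, f 1, …`. -/
def consSeq {α : Type*} (a : α) (f : ℕ → α) : ℕ → α
  | 0 => a
  | k + 1 => f k

theorem sum_fin_cons {α M : Type*} [Fintype α] [AddCommMonoid M] {n : ℕ}
    (f : (Fin (n + 1) → α) → M) :
    ∑ t, f t = ∑ a, ∑ t : Fin n → α, f (Fin.cons a t) := by
  rw [← Fintype.sum_prod_type', ← (Fin.consEquiv fun _ => α).sum_comp]
  rfl

theorem ofFn_val_succ {α : Type*} {n : ℕ} (f : ℕ → α) :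
    (List.ofFn fun j : Fin (n + 1) => f j) = f 0 :: List.ofFn fun j : Fin n => f (j + 1) := by
  rw [List.ofFn_succ]
  rfl

/-! ### Rows and grids as sums over fillings -/

section Rows

variable {R : Type*} [CommRing R]

theorem westRow_sum {ι : Type*} (s : Finset ι) (x : R) (y : ℕ → R) (l : List (WithTop ℕ))
    (F : ι → List (WithTop ℕ) → WithTop ℕ → R) :
    westRow x y l (fun t h => ∑ i ∈ s, F i t h) = ∑ i ∈ s, westRow x y l (F i) := by
  classical
  induction s using Finset.induction_on with
  | empty => simp [westRow_zero]
  | insert a s ha ih => simp only [sum_insert ha, westRow_add, ih]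

theorem eastRow_sum {ι : Type*} (s : Finset ι) (x : R) (y : ℕ → R) (l : List (WithTop ℕ))
    (h : WithTop ℕ) (F : ι → List (WithTop ℕ) → WithTop ℕ → R) :
    eastRow x y l h (fun t h => ∑ i ∈ s, F i t h) = ∑ i ∈ s, eastRow x y l h (F i) := by
  classical
  induction s using Finset.induction_on with
  | empty => simp [eastRow_zero]
  | insert a s ha ih => simp only [sum_insert ha, eastRow_add, ih]

open Classical in
-- The labels are bound by an existential and not summed over: inside the row a filling determines
-- them from the North and East, and outside the row the values of `H` and `S` are arbitrary.
theorem westRow_eq_sum {n : ℕ} (x : R) (y : ℕ → R) (N : ℕ → WithTop ℕ)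
    (P : List (WithTop ℕ) → WithTop ℕ → Prop) :
    westRow x y (List.ofFn fun j : Fin n => N j) (fun s h => if P s h then 1 else 0) =
      ∑ t : Fin n → Tile, (∏ j : Fin n, cellWeight .west (x - y j) (t j)) *
        if ∃ H S : ℕ → WithTop ℕ, H n = ⊤ ∧
          (∀ j : Fin n, CellOk .west (t j) (H j) (S j) (N j) (H (j + 1))) ∧
          P (List.ofFn fun j : Fin n => S j) (H 0) then 1 else 0 := by
  induction n generalizing y N P with
  | zero =>
    have : (∃ H : ℕ → WithTop ℕ, H 0 = ⊤ ∧ P [] (H 0)) ↔ P [] ⊤ :=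
      ⟨fun ⟨H, h1, h2⟩ => h1 ▸ h2, fun h => ⟨fun _ => ⊤, rfl, h⟩⟩
    simp [westRow, this]
  | succ n ih =>
    rw [ofFn_val_succ, westRow, sum_fin_cons]
    have hF : (fun s h => (if P (h :: s) (N 0) then (1 : R) else 0) +
        if h < N 0 then (x - y 0) * (if P (N 0 :: s) h then 1 else 0) else 0) =
        fun s h => ∑ t, cellWeight .west (x - y 0) t *
          if ∃ s₀ w, CellOk .west t w s₀ (N 0) h ∧ P (s₀ :: s) w then 1 else 0 := by
      funext s h
      exact (sum_west_cell (x - y 0) (N 0) h (fun s₀ w => P (s₀ :: s) w)).symm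
    rw [hF, westRow_sum]
    refine sum_congr rfl fun t₀ _ => ?_
    rw [westRow_mul, ih (fun k => y (k + 1)) (fun k => N (k + 1))
      (fun s h => ∃ s₀ w, CellOk .west t₀ w s₀ (N 0) h ∧ P (s₀ :: s) w), mul_sum]
    refine sum_congr rfl fun t _ => ?_
    rw [Fin.prod_univ_succ, ← mul_assoc]
    congr 1
    refine if_congr ?_ rfl rfl
    constructor
    · rintro ⟨H, S, hn, hc, s₀, w, h0, hP⟩
      refine ⟨consSeq w H, consSeq s₀ S, hn, fun j => ?_, ?_⟩
      · refine Fin.cases ?_ (fun j => ?_) j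
        · exact h0
        · exact hc j
      · rw [List.ofFn_succ]
        exact hP
    · rintro ⟨H, S, hn, hc, hP⟩
      refine ⟨fun k => H (k + 1), fun k => S (k + 1), hn, fun j => hc j.succ, S 0, H 0, hc 0, ?_⟩
      rw [List.ofFn_succ] at hP
      exact hP

open Classical in
theorem eastRow_eq_sum {n : ℕ} (x : R) (y : ℕ → R) (N : ℕ → WithTop ℕ) (h₀ : WithTop ℕ)
    (P : List (WithTop ℕ) → WithTop ℕ → Prop) :
    eastRow x y (List.ofFn fun j : Fin n => N j) h₀ (fun s h => if P s h then 1 else 0) =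
      ∑ t : Fin n → Tile, (∏ j : Fin n, cellWeight .east (x - y j) (t j)) *
        if ∃ H S : ℕ → WithTop ℕ, H 0 = h₀ ∧
          (∀ j : Fin n, CellOk .east (t j) (H j) (S j) (N j) (H (j + 1))) ∧
          P (List.ofFn fun j : Fin n => S j) (H n) then 1 else 0 := by
  induction n generalizing y N P h₀ with
  | zero =>
    have : (∃ H : ℕ → WithTop ℕ, H 0 = h₀ ∧ P [] (H 0)) ↔ P [] h₀ :=
      ⟨fun ⟨H, h1, h2⟩ => h1 ▸ h2, fun h => ⟨fun _ => h₀, rfl, h⟩⟩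
    simp [eastRow, this]
  | succ n ih =>
    -- `eastRow` splits on the first cell outside the recursive call, so the sum over the other
    -- tiles comes first and the first tile is summed at the end.
    rw [ofFn_val_succ, eastRow, sum_fin_cons, sum_comm]
    have hI := fun s₀ h₁ => ih (fun k => y (k + 1)) (fun k => N (k + 1)) h₁
      (fun s h => P (s₀ :: s) h)
    simp only [hI]
    have hlin : ∀ (p q r : Prop) [Decidable p] [Decidable q] [Decidable r] (c : R)
        (W A B C : (Fin n → Tile) → R),
        (if p then c * ∑ t, W t * A t else (if q then ∑ t, W t * B t else 0) +
          if r then ∑ t, W t * C t else 0) =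
        ∑ t, W t * (if p then c * A t else (if q then B t else 0) + if r then C t else 0) := by
      intro p q r _ _ _ c W A B C
      split_ifs <;> simp [mul_sum, ← sum_add_distrib, mul_add, mul_left_comm]
    rw [hlin]
    refine sum_congr rfl fun t _ => ?_
    rw [← sum_east_cell (x - y 0) (N 0) h₀ (fun s₀ h₁ => ∃ H S : ℕ → WithTop ℕ, H 0 = h₁ ∧
          (∀ j : Fin n, CellOk .east (t j) (H j) (S j) (N (j + 1)) (H (j + 1))) ∧
          P (s₀ :: List.ofFn fun j : Fin n => S j) (H n)), mul_sum]
    refine sum_congr rfl fun t₀ _ => ?_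
    rw [Fin.prod_univ_succ, mul_left_comm, ← mul_assoc]
    congr 1
    refine if_congr ?_ rfl rfl
    constructor
    · rintro ⟨s₀, e, h0, H, S, rfl, hc, hP⟩
      refine ⟨consSeq h₀ H, consSeq s₀ S, rfl, fun j => ?_, ?_⟩
      · refine Fin.cases ?_ (fun j => ?_) j
        · exact h0
        · exact hc j
      · rw [List.ofFn_succ]
        exact hP
    · rintro ⟨H, S, rfl, hc, hP⟩
      refine ⟨S 0, H 1, hc 0, fun k => H (k + 1), fun k => S (k + 1), rfl, fun j => hc j.succ, ?_⟩
      rw [List.ofFn_succ] at hP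
      exact hP

/-- A labelling of the edges of the grid: `h i j` is the label of the West side of the cell
`(i, j)`, `v i j` the label of its North side, and `lab i` the label of the pipe that enters in
row `i`. -/
structure IsLabelling {m n : ℕ} (β : Fin m → RowType) (lab : Fin m → ℕ) (D : Filling m n)
    (h v : ℕ → ℕ → WithTop ℕ) : Prop where
  cell : ∀ (i : Fin m) (j : Fin n),
    CellOk (β i) (D i j) (h i j) (v (i + 1) j) (v i j) (h i (j + 1))
  west : ∀ i : Fin m, h i 0 = if β i = .west then (lab i : WithTop ℕ) else ⊤
  east : ∀ i : Fin m, h i n = if β i = .west then ⊤ else (lab i : WithTop ℕ)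
  south : ∀ j : Fin n, v m j = ⊤

theorem isLabelling_succ_iff {m n : ℕ} {β : Fin (m + 1) → RowType} {lab : Fin (m + 1) → ℕ}
    {D : Filling (m + 1) n} {h v : ℕ → ℕ → WithTop ℕ} :
    IsLabelling β lab D h v ↔
      (∀ j : Fin n, CellOk (β 0) (D 0 j) (h 0 j) (v 1 j) (v 0 j) (h 0 (j + 1))) ∧
      h 0 0 = (if β 0 = .west then (lab 0 : WithTop ℕ) else ⊤) ∧
      h 0 n = (if β 0 = .west then ⊤ else (lab 0 : WithTop ℕ)) ∧
      IsLabelling (fun i => β i.succ) (fun i => lab i.succ) (fun i => D i.succ)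
        (fun k => h (k + 1)) (fun k => v (k + 1)) := by
  constructor
  · intro H
    exact ⟨H.cell 0, H.west 0, H.east 0, fun i => H.cell i.succ, fun i => H.west i.succ,
      fun i => H.east i.succ, H.south⟩
  · rintro ⟨h1, h2, h3, h4⟩
    exact ⟨fun i => Fin.cases h1 h4.cell i, fun i => Fin.cases h2 h4.west i,
      fun i => Fin.cases h3 h4.east i, h4.south⟩

open Classical in
/-- The partition function is the weighted sum over the fillings that admit a labelling. -/
theorem partitionFn_eq_sum {m n : ℕ} (x y : ℕ → R) (β : Fin m → RowType) (lab : Fin m → ℕ)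
    (l : List (WithTop ℕ)) (hl : l.length = n) :
    partitionFn x y (List.ofFn fun i => (β i, lab i)) l =
      ∑ D : Filling m n, (∏ i, ∏ j : Fin n, cellWeight (β i) (x (lab i) - y j) (D i j)) *
        if ∃ h v, IsLabelling β lab D h v ∧ (List.ofFn fun j : Fin n => v 0 j) = l
          then 1 else 0 := by
  induction m generalizing l with
  | zero =>
    have : (∃ h v, IsLabelling β lab (default : Filling 0 n) h v ∧
        (List.ofFn fun j : Fin n => v 0 j) = l) ↔ ∀ a ∈ l, a = ⊤ := by
      constructor
      · rintro ⟨h, v, H, rfl⟩ a ha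
        obtain ⟨j, rfl⟩ := (List.mem_ofFn' _ _).1 ha
        exact H.south j
      · intro ha
        refine ⟨fun _ _ => ⊤, fun _ _ => ⊤, ⟨fun i => i.elim0, fun i => i.elim0,
          fun i => i.elim0, fun _ => rfl⟩, ?_⟩
        refine List.ext_getElem (by simp [hl]) fun k h1 h2 => ?_
        rw [List.getElem_ofFn, ha _ (List.getElem_mem h2)]
    rw [Fintype.sum_unique]
    simp [partitionFn, this]
  | succ m ih =>
    obtain ⟨N, rfl⟩ : ∃ N : ℕ → WithTop ℕ, l = List.ofFn fun j : Fin n => N j := by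
      refine ⟨fun k => l.getD k ⊤, List.ext_getElem (by simp [hl]) fun k h1 h2 => ?_⟩
      rw [List.getElem_ofFn]
      exact (List.getD_eq_getElem _ _ h1).symm
    have hlab : ∀ t D, (∃ h v, IsLabelling β lab (Fin.cons t D : Filling (m + 1) n) h v ∧
        (List.ofFn fun j : Fin n => v 0 j) = List.ofFn fun j : Fin n => N j) ↔
        ∃ H S : ℕ → WithTop ℕ, H 0 = (if β 0 = .west then (lab 0 : WithTop ℕ) else ⊤) ∧
          H n = (if β 0 = .west then ⊤ else (lab 0 : WithTop ℕ)) ∧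
          (∀ j : Fin n, CellOk (β 0) (t j) (H j) (S j) (N j) (H (j + 1))) ∧
          ∃ h v, IsLabelling (fun i => β i.succ) (fun i => lab i.succ) D h v ∧
            (List.ofFn fun j : Fin n => v 0 j) = List.ofFn fun j : Fin n => S j := by
      intro t D
      simp only [isLabelling_succ_iff, Fin.cons_zero, Fin.cons_succ, List.ofFn_inj, funext_iff]
      constructor
      · rintro ⟨h, v, ⟨h1, h2, h3, h4⟩, h5⟩
        exact ⟨h 0, v 1, h2, h3, fun j => h5 j ▸ h1 j, _, _, h4, fun _ => rfl⟩
      · rintro ⟨H, S, h2, h3, h1, h, v, h4, h5⟩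
        refine ⟨consSeq H h, consSeq N v, ⟨fun j => ?_, h2, h3, h4⟩, fun _ => rfl⟩
        have := h1 j
        rw [← h5 j] at this
        exact this
    obtain ⟨P, hP⟩ : ∃ P : ℕ → Filling m n → List (WithTop ℕ) → WithTop ℕ → Prop, ∀ a D s h,
        P a D s h ↔ h = a ∧
          ∃ h v, IsLabelling (fun i => β i.succ) (fun i => lab i.succ) D h v ∧
            (List.ofFn fun j : Fin n => v 0 j) = s := ⟨_, fun _ _ _ _ => Iff.rfl⟩
    have hZ : ∀ (s : List (WithTop ℕ)) (h : WithTop ℕ) (a : ℕ), s.length = n →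
        (if h = a then partitionFn x y (List.ofFn fun i : Fin m => (β i.succ, lab i.succ)) s
          else 0) = ∑ D : Filling m n,
          (∏ i : Fin m, ∏ j : Fin n, cellWeight (β i.succ) (x (lab i.succ) - y j) (D i j)) *
          if P a D s h then 1 else 0 := by
      intro s h a hs
      by_cases hh : h = a
      · simp only [hP, hh, if_true, true_and]
        exact ih _ _ _ hs
      · simp [hP, hh]
    rw [List.ofFn_succ, sum_fin_cons, sum_comm]
    simp only [hlab, Fin.prod_univ_succ, Fin.cons_zero, Fin.cons_succ]
    cases hβ : β 0
    · rw [partitionFn]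
      refine (westRow_congr _ _ _ fun s h hs => hZ s h (lab 0) (by simpa using hs)).trans ?_
      rw [westRow_sum]
      refine sum_congr rfl fun D _ => ?_
      rw [westRow_mul, westRow_eq_sum (x (lab 0)) y N (P (lab 0) D), mul_sum]
      refine sum_congr rfl fun t _ => ?_
      rw [← mul_assoc, mul_comm (∏ i : Fin m, _)]
      congr 1
      refine if_congr ?_ rfl rfl
      refine exists_congr fun H => exists_congr fun S => ?_
      simp only [if_true, hP]
      tauto
    · rw [partitionFn]
      refine (eastRow_congr _ _ _ _ fun s h hs => hZ s h (lab 0) (by simpa using hs)).trans ?_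
      rw [eastRow_sum]
      refine sum_congr rfl fun D _ => ?_
      rw [eastRow_mul, eastRow_eq_sum (x (lab 0)) y N ⊤ (P (lab 0) D), mul_sum]
      refine sum_congr rfl fun t _ => ?_
      rw [← mul_assoc, mul_comm (∏ i : Fin m, _)]
      congr 1
      refine if_congr ?_ rfl rfl
      refine exists_congr fun H => exists_congr fun S => ?_
      simp only [reduceCtorEq, if_false, hP]
      tauto

end Rows

end HybridPipeDream

namespace HybridPipeDream

/-! ### Labellings without the condition on crossings -/

/-- The labels of the sides of the cell `(i, j)`. -/
def cellLabels (h v : ℕ → ℕ → WithTop ℕ) (i j : ℕ) : Side → WithTop ℕ :=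
  sideLabels (h i j) (v (i + 1) j) (v i j) (h i (j + 1))

/-- A labelling of the edges of the grid that is compatible with the strands of the tiles. -/
structure IsPreLabelling {m n : ℕ} (β : Fin m → RowType) (lab : Fin m → ℕ) (D : Filling m n)
    (h v : ℕ → ℕ → WithTop ℕ) : Prop where
  allowed : ∀ i j, (D i j).Allowed (β i)
  strands : ∀ (i : Fin m) (j : Fin n), Strands (D i j) (cellLabels h v i j)
  west : ∀ i : Fin m, h i 0 = if β i = .west then (lab i : WithTop ℕ) else ⊤
  east : ∀ i : Fin m, h i n = if β i = .west then ⊤ else (lab i : WithTop ℕ)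
  south : ∀ j : Fin n, v m j = ⊤

theorem isLabelling_iff {m n : ℕ} {β : Fin m → RowType} {lab : Fin m → ℕ} {D : Filling m n}
    {h v : ℕ → ℕ → WithTop ℕ} :
    IsLabelling β lab D h v ↔ IsPreLabelling β lab D h v ∧
      ∀ (i : Fin m) (j : Fin n), CrossOrder (β i) (D i j) (cellLabels h v i j) :=
  ⟨fun H => ⟨⟨fun i j => (H.cell i j).1, fun i j => (H.cell i j).2.1, H.west, H.east, H.south⟩,
    fun i j => (H.cell i j).2.2⟩,
   fun ⟨H, ho⟩ => ⟨fun i j => ⟨H.allowed i j, H.strands i j, ho i j⟩, H.west, H.east, H.south⟩⟩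

/-- The three effects of a cell on the word along a path that is pushed over it: no change, an
exchange with an empty edge, an exchange of two pipes. -/
theorem Strands.west_cases {t : Tile} {W S N E : WithTop ℕ} (ht : t.Allowed .west)
    (hs : Strands t (sideLabels W S N E)) :
    (t ≠ .cross ∧ N = W ∧ E = S) ∨ (t ≠ .cross ∧ N = S ∧ E = W ∧ (W = ⊤ ∨ S = ⊤)) ∨
      (t = .cross ∧ N = S ∧ E = W ∧ W ≠ ⊤ ∧ S ≠ ⊤) := by
  cases t <;> simp [Strands, Side.forall_iff, Tile.other, Side.opp, sideLabels, Tile.Allowed]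
    at ht hs ⊢ <;> grind

theorem Strands.east_cases {t : Tile} {W S N E : WithTop ℕ} (ht : t.Allowed .east)
    (hs : Strands t (sideLabels W S N E)) :
    (t ≠ .cross ∧ W = S ∧ N = E) ∨ (t ≠ .cross ∧ W = E ∧ N = S ∧ (S = ⊤ ∨ E = ⊤)) ∨
      (t = .cross ∧ W = E ∧ N = S ∧ S ≠ ⊤ ∧ E ≠ ⊤) := by
  cases t <;> simp [Strands, Side.forall_iff, Tile.other, Side.opp, sideLabels, Tile.Allowed]
    at ht hs ⊢ <;> grind

/-! ### Words -/

/-- In the word `ω` the label `a` stands before the label `b`. -/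
def Precedes (ω : ℕ → WithTop ℕ) (a b : ℕ) : Prop := ∃ k k', k < k' ∧ ω k = a ∧ ω k' = b

theorem Precedes.of_swap {ω : ℕ → WithTop ℕ} {k a b : ℕ}
    (h : Precedes (fun l => ω (Equiv.swap k (k + 1) l)) a b) :
    Precedes ω a b ∨ (ω k = b ∧ ω (k + 1) = a) := by
  obtain ⟨l, l', hl, h1, h2⟩ := h
  by_cases hlt : Equiv.swap k (k + 1) l < Equiv.swap k (k + 1) l'
  · exact Or.inl ⟨_, _, hlt, h1, h2⟩
  · have : l = k ∧ l' = k + 1 := by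
      simp only [Equiv.swap_apply_def] at hlt
      split_ifs at hlt <;> omega
    obtain ⟨rfl, rfl⟩ := this
    simp only [Equiv.swap_apply_left, Equiv.swap_apply_right] at h1 h2
    exact Or.inr ⟨h2, h1⟩

theorem Precedes.swap {ω : ℕ → WithTop ℕ} {k a b : ℕ} (h : Precedes ω a b) :
    Precedes (fun l => ω (Equiv.swap k (k + 1) l)) a b ∨ (ω k = a ∧ ω (k + 1) = b) := by
  have h' : Precedes (fun l => (fun l => ω (Equiv.swap k (k + 1) l)) (Equiv.swap k (k + 1) l))
      a b := by simpa using h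
  rcases Precedes.of_swap (ω := fun l => ω (Equiv.swap k (k + 1) l)) h' with h | ⟨h1, h2⟩
  · exact Or.inl h
  · simp only [Equiv.swap_apply_left, Equiv.swap_apply_right] at h1 h2
    exact Or.inr ⟨h2, h1⟩

/-- The pipes with labels `a` and `b` cross in the cell `(i, j)`. -/
def LabelsCross {m n : ℕ} (D : Filling m n) (h v : ℕ → ℕ → WithTop ℕ) (i : Fin m) (j : Fin n)
    (a b : ℕ) : Prop :=
  D i j = .cross ∧ ((h i j = a ∧ v i j = b) ∨ (h i j = b ∧ v i j = a))

/-- The word `ω` is read off along a path from the West to the East side of the grid, and `P` is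
the set of the cells below this path: two labels are in the wrong order if and only if their
pipes cross below the path. -/
structure WordInv {m n : ℕ} (β : Fin m → RowType) (lab : Fin m → ℕ) (D : Filling m n)
    (h v : ℕ → ℕ → WithTop ℕ) (P : Fin m → Fin n → Prop) (ω : ℕ → WithTop ℕ) (i₀ : ℕ) :
    Prop where
  inj : ∀ k k' (a : ℕ), ω k = a → ω k' = a → k = k'
  crossed : ∀ a b, a < b → Precedes ω b a → ∃ i j, P i j ∧ LabelsCross D h v i j a b
  order : (∀ i j, CrossOrder (β i) (D i j) (cellLabels h v i j)) → ∀ i j, P i j → ∀ a b, a < b →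
    LabelsCross D h v i j a b → Precedes ω b a
  rows : ∀ k, ω k ≠ ⊤ → ∃ r : Fin m, i₀ ≤ r.val ∧ ω k = lab r

section

variable {m n : ℕ} {β : Fin m → RowType} {lab : Fin m → ℕ} {D : Filling m n}
  {h v : ℕ → ℕ → WithTop ℕ} {P P' : Fin m → Fin n → Prop} {ω : ℕ → WithTop ℕ} {i₀ : ℕ}

theorem WordInv.congr_cells (H : WordInv β lab D h v P ω i₀) (hP : ∀ i j, P i j ↔ P' i j) :
    WordInv β lab D h v P' ω i₀ := by
  obtain rfl : P = P' := funext fun i => funext fun j => propext (hP i j)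
  exact H

theorem WordInv.add_cell (H : WordInv β lab D h v P ω i₀) (i : Fin m) (j : Fin n)
    (hc : D i j ≠ .cross) :
    WordInv β lab D h v (fun i' j' => P i' j' ∨ (i' = i ∧ j' = j)) ω i₀ where
  inj := H.inj
  crossed a b hab hp := by
    obtain ⟨i', j', h1, h2⟩ := H.crossed a b hab hp
    exact ⟨i', j', Or.inl h1, h2⟩
  order ho i' j' hP a b hab hx := by
    rcases hP with hP | ⟨rfl, rfl⟩
    · exact H.order ho i' j' hP a b hab hx
    · exact absurd hx.1 hc
  rows := H.rows

theorem WordInv.swap_top (H : WordInv β lab D h v P ω i₀) {k : ℕ} (hk : ω k = ⊤ ∨ ω (k + 1) = ⊤) :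
    WordInv β lab D h v P (fun l => ω (Equiv.swap k (k + 1) l)) i₀ where
  inj l l' a h1 h2 := (Equiv.swap k (k + 1)).injective (H.inj _ _ a h1 h2)
  crossed a b hab hp := by
    rcases hp.of_swap with hp | ⟨h1, h2⟩
    · exact H.crossed a b hab hp
    · simp [h1, h2] at hk
  order ho i' j' hP a b hab hx := by
    rcases (H.order ho i' j' hP a b hab hx).swap (k := k) with hp | ⟨h1, h2⟩
    · exact hp
    · simp [h1, h2] at hk
  rows l hl := H.rows _ hl

/-- Recording the new crossing needs no assumption on the order. Only the field `order` uses that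
the two labels came in uncrossed, so that an earlier inversion is never undone. -/
theorem WordInv.swap_cross (H : WordInv β lab D h v P ω i₀) {k : ℕ} (i : Fin m) (j : Fin n)
    (hc : D i j = .cross) (hne : ω k ≠ ⊤) (hne' : ω (k + 1) ≠ ⊤)
    (hin : (h i j = ω k ∧ v i j = ω (k + 1)) ∨ (h i j = ω (k + 1) ∧ v i j = ω k))
    (hord : CrossOrder (β i) (D i j) (cellLabels h v i j) → ω k < ω (k + 1)) :
    WordInv β lab D h v (fun i' j' => P i' j' ∨ (i' = i ∧ j' = j))
      (fun l => ω (Equiv.swap k (k + 1) l)) i₀ where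
  inj l l' a h1 h2 := (Equiv.swap k (k + 1)).injective (H.inj _ _ a h1 h2)
  crossed a b hab hp := by
    rcases hp.of_swap with hp | ⟨h1, h2⟩
    · obtain ⟨i', j', h1, h2⟩ := H.crossed a b hab hp
      exact ⟨i', j', Or.inl h1, h2⟩
    · rw [h1, h2] at hin
      exact ⟨i, j, Or.inr ⟨rfl, rfl⟩, hc, hin⟩
  order ho i' j' hP a b hab hx := by
    have hlt := hord (ho i j)
    rcases hP with hP | ⟨rfl, rfl⟩
    · rcases (H.order ho i' j' hP a b hab hx).swap (k := k) with hp | ⟨h1, h2⟩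
      · exact hp
      · rw [h1, h2] at hlt
        exact absurd (by exact_mod_cast hlt : b < a) hab.not_gt
    · refine ⟨k, k + 1, by omega, ?_⟩
      simp only [Equiv.swap_apply_left, Equiv.swap_apply_right]
      obtain ⟨p, hp⟩ := WithTop.ne_top_iff_exists.1 hne
      obtain ⟨q, hq⟩ := WithTop.ne_top_iff_exists.1 hne'
      have hx2 := hx.2
      rw [← hp, ← hq] at hin hlt ⊢
      have hpq : p < q := by exact_mod_cast hlt
      rcases hin with ⟨h1, h2⟩ | ⟨h1, h2⟩ <;> rw [h1, h2] at hx2 <;>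
        rcases hx2 with ⟨h3, h4⟩ | ⟨h3, h4⟩ <;>
        have h3' := WithTop.coe_injective h3 <;> have h4' := WithTop.coe_injective h4 <;>
        subst h3' <;> subst h4' <;> first | exact ⟨rfl, rfl⟩ | omega
  rows l hl := H.rows _ hl

/-- The new pipe has a smaller label than all pipes from below and stands first, so it creates no
inversion. -/
theorem WordInv.insert_left (H : WordInv β lab D h v P ω (i₀ + 1)) (hi : i₀ < m)
    (hlab : ∀ r : Fin m, i₀ < r.val → lab ⟨i₀, hi⟩ < lab r) :
    WordInv β lab D h v P (consSeq (lab ⟨i₀, hi⟩ : WithTop ℕ) ω) i₀ where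
  inj k k' a h1 h2 := by
    have key : ∀ k, ω k = (lab ⟨i₀, hi⟩ : ℕ) → False := by
      intro k hk
      obtain ⟨r, hr, hr'⟩ := H.rows k (by simp [hk])
      rw [hk] at hr'
      exact (hlab r hr).ne (by exact_mod_cast hr')
    rcases k with _ | k <;> rcases k' with _ | k' <;> simp only [consSeq] at h1 h2
    · rfl
    · exact (key k' (h2.trans h1.symm)).elim
    · exact (key k (h1.trans h2.symm)).elim
    · rw [H.inj k k' a h1 h2]
  crossed a b hab hp := by
    refine H.crossed a b hab ?_
    obtain ⟨k, k', hk, h1, h2⟩ := hp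
    rcases k' with _ | k'
    · omega
    simp only [consSeq] at h2
    rcases k with _ | k <;> simp only [consSeq] at h1
    · obtain ⟨r, hr, hr'⟩ := H.rows k' (by simp [h2])
      have h3 := hlab r hr
      rw [h2] at hr'
      have h4 : a = lab r := by exact_mod_cast hr'
      have h5 : lab ⟨i₀, hi⟩ = b := by exact_mod_cast h1
      omega
    · exact ⟨k, k', by omega, h1, h2⟩
  order ho i' j' hP a b hab hx := by
    obtain ⟨k, k', hk, h1, h2⟩ := H.order ho i' j' hP a b hab hx
    exact ⟨k + 1, k' + 1, by omega, h1, h2⟩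
  rows k hk := by
    rcases k with _ | k
    · exact ⟨⟨i₀, hi⟩, le_rfl, rfl⟩
    · obtain ⟨r, hr, hr'⟩ := H.rows k hk
      exact ⟨r, by omega, hr'⟩

/-- The word is empty from position `n` on, so the new label stands last; being the largest, it
creates no inversion. -/
theorem WordInv.insert_right (H : WordInv β lab D h v P ω (i₀ + 1)) (hi : i₀ < m)
    (hlab : ∀ r : Fin m, i₀ < r.val → lab r < lab ⟨i₀, hi⟩) (hω : ∀ k, n ≤ k → ω k = ⊤) :
    WordInv β lab D h v P (fun k => if k = n then (lab ⟨i₀, hi⟩ : WithTop ℕ) else ω k) i₀ where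
  inj k k' a h1 h2 := by
    have key : ∀ k, ω k = (lab ⟨i₀, hi⟩ : ℕ) → False := by
      intro k hk
      obtain ⟨r, hr, hr'⟩ := H.rows k (by simp [hk])
      rw [hk] at hr'
      exact (hlab r hr).ne' (by exact_mod_cast hr')
    split_ifs at h1 h2 with h3 h4 h4
    · omega
    · exact (key k' (h2.trans h1.symm)).elim
    · exact (key k (h1.trans h2.symm)).elim
    · exact H.inj k k' a h1 h2
  crossed a b hab hp := by
    refine H.crossed a b hab ?_
    obtain ⟨k, k', hk, h1, h2⟩ := hp
    simp only at h1 h2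
    split_ifs at h1 h2 with h3 h4 h4
    · omega
    · rw [hω k' (by omega)] at h2
      simp at h2
    · obtain ⟨r, hr, hr'⟩ := H.rows k (by simp [h1])
      have h3 := hlab r hr
      rw [h1] at hr'
      have h4 : b = lab r := by exact_mod_cast hr'
      have h5 : lab ⟨i₀, hi⟩ = a := by exact_mod_cast h2
      omega
    · exact ⟨k, k', by omega, h1, h2⟩
  order ho i' j' hP a b hab hx := by
    obtain ⟨k, k', hk, h1, h2⟩ := H.order ho i' j' hP a b hab hx
    have hlt : ∀ k (c : ℕ), ω k = c → k ≠ n := by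
      rintro k c hk rfl
      rw [hω k le_rfl] at hk
      simp at hk
    exact ⟨k, k', hk, by simp only [if_neg (hlt k _ h1), h1],
      by simp only [if_neg (hlt k' _ h2), h2]⟩
  rows k hk := by
    split_ifs at hk ⊢
    · exact ⟨⟨i₀, hi⟩, le_rfl, rfl⟩
    · obtain ⟨r, hr, hr'⟩ := H.rows k hk
      exact ⟨r, by omega, hr'⟩

theorem WordInv.delete_left (H : WordInv β lab D h v P ω i₀) (h0 : ω 0 = ⊤) :
    WordInv β lab D h v P (fun k => ω (k + 1)) i₀ where
  inj k k' a h1 h2 := by simpa using H.inj _ _ a h1 h2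
  crossed a b hab hp := by
    obtain ⟨k, k', hk, h1, h2⟩ := hp
    exact H.crossed a b hab ⟨k + 1, k' + 1, by omega, h1, h2⟩
  order ho i' j' hP a b hab hx := by
    obtain ⟨k, k', hk, h1, h2⟩ := H.order ho i' j' hP a b hab hx
    rcases k with _ | k
    · rw [h0] at h1
      simp at h1
    rcases k' with _ | k'
    · omega
    exact ⟨k, k', by omega, h1, h2⟩
  rows k hk := H.rows _ hk

/-! ### The words along the rows -/

/-- The labels along the path that passes above the first `j` cells of row `i` and below the
others. -/
def westWord (h v : ℕ → ℕ → WithTop ℕ) (i j k : ℕ) : WithTop ℕ :=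
  if k < j then v i k else if k = j then h i j else v (i + 1) (k - 1)

/-- The labels along the path that passes below the first `j` cells of row `i` and above the
others. -/
def eastWord (h v : ℕ → ℕ → WithTop ℕ) (i j k : ℕ) : WithTop ℕ :=
  if k < j then v (i + 1) k else if k = j then h i j else v i (k - 1)

theorem westWord_succ_of_eq {i j : ℕ} (h1 : v i j = h i j) (h2 : h i (j + 1) = v (i + 1) j) :
    westWord h v i (j + 1) = westWord h v i j := by
  funext k
  simp only [westWord]
  rcases lt_trichotomy k j with hk | rfl | hk
  · rw [if_pos (by omega), if_pos hk]
  · simp [h1]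
  · by_cases hk' : k = j + 1
    · subst hk'
      simp [h2]
    · rw [if_neg (by omega), if_neg (by omega), if_neg (by omega), if_neg (by omega)]

theorem westWord_succ_of_swap {i j : ℕ} (h1 : v i j = v (i + 1) j) (h2 : h i (j + 1) = h i j) :
    westWord h v i (j + 1) = fun k => westWord h v i j (Equiv.swap j (j + 1) k) := by
  funext k
  rcases lt_trichotomy k j with hk | rfl | hk
  · rw [Equiv.swap_apply_of_ne_of_ne (by omega) (by omega)]
    simp only [westWord]
    rw [if_pos (by omega), if_pos hk]
  · rw [Equiv.swap_apply_left]
    simp [westWord, h1]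
  · by_cases hk' : k = j + 1
    · subst hk'
      rw [Equiv.swap_apply_right]
      simp [westWord, h2]
    · rw [Equiv.swap_apply_of_ne_of_ne (by omega) (by omega)]
      simp only [westWord]
      rw [if_neg (by omega), if_neg (by omega), if_neg (by omega), if_neg (by omega)]

theorem eastWord_of_eq {i j : ℕ} (h1 : h i j = v (i + 1) j) (h2 : v i j = h i (j + 1)) :
    eastWord h v i j = eastWord h v i (j + 1) := by
  funext k
  simp only [eastWord]
  rcases lt_trichotomy k j with hk | rfl | hk
  · rw [if_pos hk, if_pos (by omega)]
  · simp [h1]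
  · by_cases hk' : k = j + 1
    · subst hk'
      simp [h2]
    · rw [if_neg (by omega), if_neg (by omega), if_neg (by omega), if_neg (by omega)]

theorem eastWord_of_swap {i j : ℕ} (h1 : v i j = v (i + 1) j) (h2 : h i j = h i (j + 1)) :
    eastWord h v i j = fun k => eastWord h v i (j + 1) (Equiv.swap j (j + 1) k) := by
  funext k
  rcases lt_trichotomy k j with hk | rfl | hk
  · rw [Equiv.swap_apply_of_ne_of_ne (by omega) (by omega)]
    simp only [eastWord]
    rw [if_pos hk, if_pos (by omega)]
  · rw [Equiv.swap_apply_left]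
    simp [eastWord, h2]
  · by_cases hk' : k = j + 1
    · subst hk'
      rw [Equiv.swap_apply_right]
      simp [eastWord, h1]
    · rw [Equiv.swap_apply_of_ne_of_ne (by omega) (by omega)]
      simp only [eastWord]
      rw [if_neg (by omega), if_neg (by omega), if_neg (by omega), if_neg (by omega)]

/-- The cell `(i', j')` is passed by the pipes before the cell `(i, j)`, where the columns are
given by their numbers. -/
def PassedBefore (β : Fin m → RowType) (i : Fin m) (j : ℕ) (i' : Fin m) (j' : Fin n) : Prop :=
  i < i' ∨ (i' = i ∧ if β i = .west then j'.val < j else j ≤ j'.val)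

/-- The pipe of row `i` is inserted on the left, then the path is pushed over the cells of the row
from West to East, as the pipes run. -/
theorem wordInv_westWord (H : IsPreLabelling β lab D h v) {i : Fin m} (hβ : β i = .west)
    (hlab : ∀ r : Fin m, i < r → lab i < lab r)
    (Hi : WordInv β lab D h v (fun i' _ => i < i') (v (i + 1)) (i + 1)) (j : ℕ) (hj : j ≤ n) :
    WordInv β lab D h v (PassedBefore β i j) (westWord h v i j) i := by
  induction j with
  | zero =>
    have hw : westWord h v i 0 = consSeq (lab i : WithTop ℕ) (v (i + 1)) := by
      funext k
      rcases k with _ | k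
      · simp [westWord, consSeq, H.west, hβ]
      · simp [westWord, consSeq]
    rw [hw]
    exact (Hi.insert_left i.isLt hlab).congr_cells fun i' j' => by simp [PassedBefore, hβ]
  | succ j ih =>
    have IH := ih (by omega)
    have hP : ∀ (i' : Fin m) (j' : Fin n), (PassedBefore β i j i' j' ∨
        (i' = i ∧ j' = ⟨j, by omega⟩)) ↔ PassedBefore β i (j + 1) i' j' := by
      intro i' j'
      simp only [PassedBefore, hβ, if_true, Fin.ext_iff, Fin.lt_def]
      omega
    have hk : westWord h v i j j = h i j := by simp [westWord]
    have hk' : westWord h v i j (j + 1) = v (i + 1) j := by simp [westWord]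
    have hA := H.allowed i ⟨j, by omega⟩
    rw [hβ] at hA
    rcases Strands.west_cases hA (H.strands i ⟨j, by omega⟩) with
      ⟨hc, h1, h2⟩ | ⟨hc, h1, h2, h3⟩ | ⟨hc, h1, h2, h3, h4⟩
    · rw [westWord_succ_of_eq h1 h2]
      exact (IH.add_cell i ⟨j, by omega⟩ hc).congr_cells hP
    · rw [westWord_succ_of_swap h1 h2]
      refine ((IH.add_cell i ⟨j, by omega⟩ hc).swap_top ?_).congr_cells hP
      rw [hk, hk']
      exact h3
    · rw [westWord_succ_of_swap h1 h2]
      refine (IH.swap_cross i ⟨j, by omega⟩ hc ?_ ?_ ?_ ?_).congr_cells hP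
      · rw [hk]; exact h3
      · rw [hk']; exact h4
      · rw [hk, hk']; exact Or.inl ⟨rfl, h1⟩
      · rw [hk, hk', hβ]; exact fun ho => ho hc

/-- The mirror image: insertion on the right and a sweep from East to West, hence the induction on
the number `d` of cells already passed. -/
theorem wordInv_eastWord (H : IsPreLabelling β lab D h v) (hout : ∀ i k, n ≤ k → v i k = ⊤)
    {i : Fin m} (hβ : β i = .east) (hlab : ∀ r : Fin m, i < r → lab r < lab i)
    (Hi : WordInv β lab D h v (fun i' _ => i < i') (v (i + 1)) (i + 1)) (d j : ℕ)
    (hj : j + d = n) : WordInv β lab D h v (PassedBefore β i j) (eastWord h v i j) i := by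
  induction d generalizing j with
  | zero =>
    obtain rfl : j = n := hj
    have hw : eastWord h v i j = fun k => if k = j then (lab i : WithTop ℕ) else v (i + 1) k := by
      funext k
      simp only [eastWord]
      split_ifs with h1 h2 h2
      · omega
      · rfl
      · simp [H.east, hβ]
      · rw [hout _ _ (by omega), hout _ _ (by omega)]
    rw [hw]
    refine (Hi.insert_right i.isLt hlab (hout _)).congr_cells fun i' j' => ?_
    simp [PassedBefore, hβ]
  | succ d ih =>
    have IH := ih (j + 1) (by omega)
    have hP : ∀ (i' : Fin m) (j' : Fin n), (PassedBefore β i (j + 1) i' j' ∨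
        (i' = i ∧ j' = ⟨j, by omega⟩)) ↔ PassedBefore β i j i' j' := by
      intro i' j'
      simp only [PassedBefore, hβ, reduceCtorEq, if_false, Fin.ext_iff, Fin.lt_def]
      omega
    have hk : eastWord h v i (j + 1) j = v (i + 1) j := by simp [eastWord]
    have hk' : eastWord h v i (j + 1) (j + 1) = h i (j + 1) := by simp [eastWord]
    have hA := H.allowed i ⟨j, by omega⟩
    rw [hβ] at hA
    rcases Strands.east_cases hA (H.strands i ⟨j, by omega⟩) with
      ⟨hc, h1, h2⟩ | ⟨hc, h1, h2, h3⟩ | ⟨hc, h1, h2, h3, h4⟩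
    · rw [eastWord_of_eq h1 h2]
      exact (IH.add_cell i ⟨j, by omega⟩ hc).congr_cells hP
    · rw [eastWord_of_swap h2 h1]
      refine ((IH.add_cell i ⟨j, by omega⟩ hc).swap_top ?_).congr_cells hP
      rw [hk, hk']
      exact h3
    · rw [eastWord_of_swap h2 h1]
      refine (IH.swap_cross i ⟨j, by omega⟩ hc ?_ ?_ ?_ ?_).congr_cells hP
      · rw [hk]; exact h3
      · rw [hk']; exact h4
      · rw [hk, hk']; exact Or.inr ⟨h1, h2⟩
      · rw [hk, hk', hβ]; exact fun ho => ho hc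

/-- The labels follow the order of the entries of the pipes. -/
def IsEntryOrder (β : Fin m → RowType) (lab : Fin m → ℕ) : Prop :=
  ∀ i r : Fin m, i < r → match β i with
    | .west => lab i < lab r
    | .east => lab r < lab i

theorem IsEntryOrder.west (hl : IsEntryOrder β lab) {i : Fin m} (hβ : β i = .west) (r : Fin m)
    (hr : i < r) : lab i < lab r := by
  have := hl i r hr
  rwa [hβ] at this

theorem IsEntryOrder.east (hl : IsEntryOrder β lab) {i : Fin m} (hβ : β i = .east) (r : Fin m)
    (hr : i < r) : lab r < lab i := by
  have := hl i r hr
  rwa [hβ] at this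

theorem wordInv_row (H : IsPreLabelling β lab D h v) (hout : ∀ i k, n ≤ k → v i k = ⊤)
    (hl : IsEntryOrder β lab) (d i : ℕ) (hi : i + d = m) :
    WordInv β lab D h v (fun i' _ => i ≤ i'.val) (v i) i := by
  induction d generalizing i with
  | zero =>
    obtain rfl : i = m := hi
    have hv : ∀ k, v i k = ⊤ := by
      intro k
      by_cases hk : k < n
      · exact H.south ⟨k, hk⟩
      · exact hout _ _ (by omega)
    refine ⟨?_, ?_, ?_, ?_⟩
    · intro k k' a h1
      simp [hv] at h1
    · rintro a b - ⟨k, k', -, h1, -⟩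
      simp [hv] at h1
    · intro _ i' _ hP
      omega
    · intro k hk
      exact absurd (hv k) hk
  | succ d ih =>
    have him : i < m := by omega
    have IH := (ih (i + 1) (by omega)).congr_cells (P' := fun i' _ => (⟨i, him⟩ : Fin m) < i')
      fun i' _ => by rw [Fin.lt_def]; rfl
    cases hβ : β ⟨i, him⟩
    · have hw := wordInv_westWord H hβ (hl.west hβ) IH n le_rfl
      have hwv : westWord h v (⟨i, him⟩ : Fin m).val n = v i := by
        funext k
        simp only [westWord]
        split_ifs with h1 h2
        · rfl
        · rw [h2, hout i n le_rfl]
          have := H.east ⟨i, him⟩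
          rwa [if_pos hβ] at this
        · rw [hout _ _ (by omega), hout _ _ (by omega)]
      rw [hwv] at hw
      refine hw.congr_cells fun i' j' => ?_
      simp only [PassedBefore, hβ, if_true, Fin.ext_iff, Fin.lt_def]
      omega
    · have hw := wordInv_eastWord H hout hβ (hl.east hβ) IH n 0 (by omega)
      have h0 : eastWord h v (⟨i, him⟩ : Fin m).val 0 0 = ⊤ := by
        have := H.west ⟨i, him⟩
        rw [hβ] at this
        simpa [eastWord] using this
      refine (hw.delete_left h0).congr_cells fun i' j' => ?_
      simp only [PassedBefore, hβ, reduceCtorEq, if_false, Fin.ext_iff, Fin.lt_def]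
      omega

/-- Two pipes do not cross twice if and only if they come uncrossed into each crossing. -/
theorem crossOrder_iff (H : IsPreLabelling β lab D h v) (hout : ∀ i k, n ≤ k → v i k = ⊤)
    (hl : IsEntryOrder β lab) :
    (∀ i j, CrossOrder (β i) (D i j) (cellLabels h v i j)) ↔
      ∀ a b, a < b → ∀ i j i' j', LabelsCross D h v i j a b → LabelsCross D h v i' j' a b →
        i = i' ∧ j = j' := by
  -- The word `ω` belongs to the path just before the cell `(i, j)`. The two inputs of the cell are
  -- its neighbouring letters `p`, `q`.
  have hword : ∀ (i : Fin m) (j : Fin n), ∃ ω k p q, ω k = p ∧ ω (k + 1) = q ∧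
      WordInv β lab D h v (fun i' j' => i < i' ∨ (i' = i ∧
        if β i = .west then j' < j else j < j')) ω i ∧
      (D i j = .cross → (CrossOrder (β i) (D i j) (cellLabels h v i j) ↔ p < q) ∧ p ≠ ⊤ ∧ q ≠ ⊤ ∧
        ((h i j = p ∧ v i j = q) ∨ (h i j = q ∧ v i j = p))) := by
    intro i j
    have IH := (wordInv_row H hout hl (m - (i + 1)) (i + 1) (by omega)).congr_cells
      (P' := fun i' _ => i < i') fun i' _ => by rw [Fin.lt_def]; rfl
    have hA := H.allowed i j
    cases hβ : β i <;> rw [hβ] at hA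
    · refine ⟨_, j, _, _, rfl, rfl, (wordInv_westWord H hβ (hl.west hβ) IH j j.isLt.le).congr_cells
        fun i' j' => ?_, fun hc => ?_⟩
      · simp [PassedBefore, hβ]
      · have hk : westWord h v i j j = h i j := by simp [westWord]
        have hk' : westWord h v i j (j + 1) = v (i + 1) j := by simp [westWord]
        rw [hk, hk']
        rcases Strands.west_cases hA (H.strands i j) with ⟨hc', -⟩ | ⟨hc', -⟩ | ⟨-, h1, h2, h3, h4⟩
        · exact absurd hc hc'
        · exact absurd hc hc'
        · exact ⟨⟨fun ho => ho hc, fun ho _ => ho⟩, h3, h4, Or.inl ⟨rfl, h1⟩⟩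
    · refine ⟨_, j, _, _, rfl, rfl, (wordInv_eastWord H hout hβ (hl.east hβ) IH (n - (j + 1))
        (j + 1) (by omega)).congr_cells fun i' j' => ?_, fun hc => ?_⟩
      · simp only [PassedBefore, hβ, reduceCtorEq, if_false, Fin.lt_def]
        rfl
      · have hk : eastWord h v i (j + 1) j = v (i + 1) j := by simp [eastWord]
        have hk' : eastWord h v i (j + 1) (j + 1) = h i (j + 1) := by simp [eastWord]
        rw [hk, hk']
        rcases Strands.east_cases hA (H.strands i j) with ⟨hc', -⟩ | ⟨hc', -⟩ | ⟨-, h1, h2, h3, h4⟩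
        · exact absurd hc hc'
        · exact absurd hc hc'
        · exact ⟨⟨fun ho => ho hc, fun ho _ => ho⟩, h3, h4, Or.inr ⟨h1, h2⟩⟩
  constructor
  · intro ho a b hab
    -- If the same pair had crossed at a cell passed earlier, the word before `(i, j)` would contain
    -- `b` before `a`. But `a` and `b` come in uncrossed there, and each label occurs only once.
    have key : ∀ i j i' j', LabelsCross D h v i j a b → LabelsCross D h v i' j' a b →
        ¬ (i < i' ∨ (i' = i ∧ if β i = .west then j' < j else j < j')) := by
      intro i j i' j' hx hx' hP
      obtain ⟨ω, k, p, q, hp, hq, hω, hc⟩ := hword i j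
      obtain ⟨hc1, hp', hq', hpq⟩ := hc hx.1
      obtain ⟨p, rfl⟩ := WithTop.ne_top_iff_exists.1 hp'
      obtain ⟨q, rfl⟩ := WithTop.ne_top_iff_exists.1 hq'
      have hlt : p < q := by exact_mod_cast hc1.1 (ho i j)
      have hab' : p = a ∧ q = b := by
        have hx2 := hx.2
        rcases hpq with ⟨h1, h2⟩ | ⟨h1, h2⟩ <;> rw [h1, h2] at hx2 <;>
          rcases hx2 with ⟨h3, h4⟩ | ⟨h3, h4⟩ <;>
          have h3' := WithTop.coe_injective h3 <;> have h4' := WithTop.coe_injective h4 <;>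
          subst h3' <;> subst h4' <;> first | exact ⟨rfl, rfl⟩ | omega
      obtain ⟨rfl, rfl⟩ := hab'
      obtain ⟨l, l', hll, h1, h2⟩ := hω.order ho i' j' hP _ _ hab hx'
      have := hω.inj _ _ _ h1 hq
      have := hω.inj _ _ _ h2 hp
      omega
    intro i j i' j' hx hx'
    have h1 := key i j i' j' hx hx'
    have h2 := key i' j' i j hx' hx
    push Not at h1 h2
    have hi : i = i' := le_antisymm h2.1 h1.1
    subst hi
    refine ⟨rfl, ?_⟩
    have h3 := h1.2 rfl
    have h4 := h2.2 rfl
    split_ifs at h3 h4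
    · exact le_antisymm (not_lt.1 h3) (not_lt.1 h4)
    · exact le_antisymm (not_lt.1 h4) (not_lt.1 h3)
  · intro hx i j hc
    obtain ⟨ω, k, p, q, hp, hq, hω, hc'⟩ := hword i j
    obtain ⟨hc1, hp', hq', hpq⟩ := hc' hc
    refine hc1.2 ?_ hc
    obtain ⟨p, rfl⟩ := WithTop.ne_top_iff_exists.1 hp'
    obtain ⟨q, rfl⟩ := WithTop.ne_top_iff_exists.1 hq'
    by_contra hlt
    have hne : p ≠ q := by
      rintro rfl
      have := hω.inj _ _ _ hp hq
      omega
    have hqp : q < p := lt_of_le_of_ne (not_lt.1 fun hl => hlt (by exact_mod_cast hl)) hne.symm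
    -- An inversion in front of the crossing comes from an earlier crossing of the same pair.
    -- Uniqueness would make it the cell `(i, j)` itself, which is not yet below the path.
    obtain ⟨i', j', hP, hx'⟩ := hω.crossed q p hqp ⟨k, k + 1, by omega, hp, hq⟩
    obtain ⟨rfl, rfl⟩ := hx q p hqp i j i' j' ⟨hc, hpq.symm⟩ hx'
    rcases hP with hP | ⟨-, hP⟩
    · exact lt_irrefl _ hP
    · split_ifs at hP <;> exact lt_irrefl _ hP

end

end HybridPipeDream

namespace HybridPipeDream

/-! ### Pipes and labels -/

/-- The sides through which pipes enter a tile in a row of the given type. -/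
def IsInput : RowType → Side → Prop
  | .west, .W => True
  | .west, .S => True
  | .east, .E => True
  | .east, .S => True
  | _, _ => False

theorem Tile.Allowed.input_of_other {b : RowType} {t : Tile} (ht : t.Allowed b) {s s' : Side}
    (hs : ¬ IsInput b s) (h : t.other s = some s') : IsInput b s' ∧ t.other s' = some s := by
  cases b <;> cases t <;> cases s <;> cases s' <;>
    simp_all [Tile.Allowed, Tile.other, IsInput, Side.opp]

theorem Strands.touches_iff {t : Tile} {e : Side → WithTop ℕ} (h : Strands t e) (s : Side) :
    t.Touches s ↔ e s ≠ ⊤ := by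
  rw [Tile.Touches]
  refine ⟨fun ht => ?_, fun he ht => he ((h s).1 ht)⟩
  obtain ⟨s', hs'⟩ := Option.ne_none_iff_exists'.1 ht
  exact ((h s).2 s' hs').1

section

variable {m n : ℕ} {β : Fin m → RowType} {lab : Fin m → ℕ} {D : Filling m n}
  {h v : ℕ → ℕ → WithTop ℕ}

theorem cellLabels_of_neighbor {s : Side} {i i' : Fin m} {j j' : Fin n}
    (hN : Neighbor s i j i' j') : cellLabels h v i' j' s.opp = cellLabels h v i j s := by
  cases s <;> obtain ⟨h1, h2⟩ := hN <;> simp only [cellLabels, sideLabels, Side.opp]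
  · rw [h1, h2]
  · rw [h1, h2]
  · rw [h1, h2]
  · rw [h1, h2]

theorem Visits.label (H : IsPreLabelling β lab D h v) {r : Fin m} {p : Place m n}
    (hp : Visits β D r p) : cellLabels h v p.row p.col p.side = lab r := by
  obtain ⟨p₀, ⟨rfl, h0⟩, hs⟩ := hp
  induction hs with
  | refl =>
    rcases h0 with ⟨hβ, hc, hs⟩ | ⟨hβ, hc, hs⟩
    · have := H.west p₀.row
      rw [if_pos hβ, ← hc] at this
      rw [hs]
      exact this
    · have := H.east p₀.row
      rw [if_neg (by simp [hβ])] at this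
      rw [hs]
      change h p₀.row (p₀.col + 1) = _
      rw [hc]
      exact this
  | @tail p q _ hst ih =>
    obtain ⟨s, h1, h2, h3⟩ := hst
    rw [h3, cellLabels_of_neighbor h2, ((H.strands _ _ _).2 s h1).2, ih]

theorem Visits.step {r : Fin m} {i i' : Fin m} {j j' : Fin n} {s s' : Side}
    (hp : Visits β D r ⟨i, j, s⟩) (ho : (D i j).other s = some s') (hN : Neighbor s' i j i' j') :
    Visits β D r ⟨i', j', s'.opp⟩ := by
  obtain ⟨p₀, h0, hs⟩ := hp
  exact ⟨p₀, h0, hs.tail ⟨s', ho, hN, rfl⟩⟩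

/-- A labelled output of a tile is reached by a pipe if the labelled inputs are. -/
theorem IsPreLabelling.visits_output (H : IsPreLabelling β lab D h v) {i : Fin m} {j : Fin n}
    (hin : ∀ s, IsInput (β i) s → cellLabels h v i j s ≠ ⊤ → ∃ r, Visits β D r ⟨i, j, s⟩)
    {s : Side} (hs : ¬ IsInput (β i) s) (hl : cellLabels h v i j s ≠ ⊤) :
    ∃ r s', Visits β D r ⟨i, j, s'⟩ ∧ (D i j).other s' = some s := by
  obtain ⟨s', hs'⟩ := Option.ne_none_iff_exists'.1 (((H.strands i j).touches_iff s).2 hl)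
  obtain ⟨h1, h2⟩ := (H.allowed i j).input_of_other hs hs'
  have h3 := (H.strands i j s).2 s' hs'
  obtain ⟨r, hr⟩ := hin s' h1 (by rw [h3.2]; exact hl)
  exact ⟨r, s', hr, h2⟩

theorem IsPreLabelling.visits_row_west (H : IsPreLabelling β lab D h v) {i : Fin m}
    (hβ : β i = .west)
    (hS : ∀ j : Fin n, v (i + 1) j ≠ ⊤ → ∃ r, Visits β D r ⟨i, j, .S⟩) (j : ℕ) (hj : j < n) :
    ∀ s, IsInput (β i) s → cellLabels h v i j s ≠ ⊤ → ∃ r, Visits β D r ⟨i, ⟨j, hj⟩, s⟩ := by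
  induction j with
  | zero =>
    intro s hs hl
    cases s <;> simp only [hβ, IsInput] at hs
    · exact hS ⟨0, hj⟩ hl
    · exact ⟨i, _, ⟨rfl, Or.inl ⟨hβ, rfl, rfl⟩⟩, .refl⟩
  | succ j ih =>
    intro s hs hl
    cases s <;> simp only [hβ, IsInput] at hs
    · exact hS ⟨j + 1, hj⟩ hl
    · obtain ⟨r, s', h1, h2⟩ := H.visits_output (j := ⟨j, by omega⟩) (ih (by omega))
        (s := .E) (by simp [hβ, IsInput]) hl
      exact ⟨r, h1.step h2 ⟨rfl, rfl⟩⟩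

theorem IsPreLabelling.visits_row_east (H : IsPreLabelling β lab D h v) {i : Fin m}
    (hβ : β i = .east)
    (hS : ∀ j : Fin n, v (i + 1) j ≠ ⊤ → ∃ r, Visits β D r ⟨i, j, .S⟩) (d j : ℕ)
    (hj : j + 1 + d = n) :
    ∀ s, IsInput (β i) s → cellLabels h v i j s ≠ ⊤ →
      ∃ r, Visits β D r ⟨i, ⟨j, by omega⟩, s⟩ := by
  induction d generalizing j with
  | zero =>
    intro s hs hl
    cases s <;> simp only [hβ, IsInput] at hs
    · exact ⟨i, _, ⟨rfl, Or.inr ⟨hβ, hj, rfl⟩⟩, .refl⟩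
    · exact hS ⟨j, by omega⟩ hl
  | succ d ih =>
    intro s hs hl
    cases s <;> simp only [hβ, IsInput] at hs
    · obtain ⟨r, s', h1, h2⟩ := H.visits_output (j := ⟨j + 1, by omega⟩) (ih (j + 1) (by omega))
        (s := .W) (by simp [hβ, IsInput]) hl
      exact ⟨r, h1.step h2 ⟨rfl, rfl⟩⟩
    · exact hS ⟨j, by omega⟩ hl

/-- Induction along the direction of the pipes, from the bottom row up and through each row from its
entry, shows that every labelled input lies on a pipe that entered at an end of some row. So there
are no closed or stray strands. -/
theorem IsPreLabelling.visits_input (H : IsPreLabelling β lab D h v) (d : ℕ) (i : Fin m)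
    (hi : i.val + 1 + d = m) (j : Fin n) :
    ∀ s, IsInput (β i) s → cellLabels h v i j s ≠ ⊤ → ∃ r, Visits β D r ⟨i, j, s⟩ := by
  induction d generalizing i j with
  | zero =>
    have hS : ∀ j : Fin n, v (i + 1) j ≠ ⊤ → ∃ r, Visits β D r ⟨i, j, .S⟩ := by
      intro j hv
      rw [show i.val + 1 = m from hi] at hv
      exact absurd (H.south j) hv
    cases hβ : β i
    · rw [← hβ]
      exact H.visits_row_west hβ hS j j.isLt
    · rw [← hβ]
      exact H.visits_row_east hβ hS (n - (j + 1)) j (by omega)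
  | succ d ih =>
    have hS : ∀ j : Fin n, v (i + 1) j ≠ ⊤ → ∃ r, Visits β D r ⟨i, j, .S⟩ := by
      intro j hv
      obtain ⟨r, s', h1, h2⟩ := H.visits_output (i := ⟨i + 1, by omega⟩)
        (ih ⟨i + 1, by omega⟩ (by simp only; omega) j) (s := .N)
        (by cases β ⟨i + 1, by omega⟩ <;> simp [IsInput]) hv
      exact ⟨r, h1.step h2 ⟨rfl, rfl⟩⟩
    cases hβ : β i
    · rw [← hβ]
      exact H.visits_row_west hβ hS j j.isLt
    · rw [← hβ]
      exact H.visits_row_east hβ hS (n - (j + 1)) j (by omega)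

theorem IsPreLabelling.exitsAt_iff (H : IsPreLabelling β lab D h v)
    (hlab : Function.Injective lab) (r : Fin m) (c : Fin n) :
    ExitsAt β D r c ↔ v 0 c = lab r := by
  constructor
  · rintro ⟨⟨i, j, s⟩, hp, h1, rfl, h2⟩
    have h3 := hp.label H
    have h4 := ((H.strands i j s).2 _ h2).2
    rw [show (Place.mk i j s).row.val = i.val from rfl] at h1
    simp only at h3
    rw [h3] at h4
    simpa [cellLabels, sideLabels, h1] using h4
  · intro hv
    have hm : 0 < m := r.pos
    obtain ⟨r', s', h1, h2⟩ := H.visits_output (i := ⟨0, hm⟩) (j := c)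
      (H.visits_input (m - 1) ⟨0, hm⟩ (by simp only; omega) c) (s := .N)
      (by cases β ⟨0, hm⟩ <;> simp [IsInput]) (by simp [cellLabels, sideLabels, hv])
    have h3 := h1.label H
    have h4 := ((H.strands _ _ _).2 _ h2).2
    simp only at h3
    rw [h3] at h4
    have h5 : v 0 c = lab r' := h4
    rw [hv] at h5
    obtain rfl : r = r' := hlab (by exact_mod_cast h5)
    exact ⟨_, h1, rfl, rfl, h2⟩

theorem Strands.cross_eq {W S N E : WithTop ℕ} (hs : Strands .cross (sideLabels W S N E)) :
    W = E ∧ N = S ∧ W ≠ ⊤ ∧ N ≠ ⊤ :=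
  ⟨((hs .E).2 .W rfl).2, ((hs .S).2 .N rfl).2, ((hs .W).2 .E rfl).1, ((hs .N).2 .S rfl).1⟩

/-- Labels are constant along pipes and distinct pipes have distinct labels, so crossings of pipes
and crossings of labels are the same thing. -/
theorem IsPreLabelling.no_double_crossing_iff (H : IsPreLabelling β lab D h v)
    (hlab : Function.Injective lab) :
    (∀ r r' i j i' j', CrossAt β D r r' i j → CrossAt β D r r' i' j' → i = i' ∧ j = j') ↔
      ∀ a b, a < b → ∀ i j i' j', LabelsCross D h v i j a b → LabelsCross D h v i' j' a b →
        i = i' ∧ j = j' := by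
  have hside : ∀ i j, D i j = .cross → ∀ r s, Visits β D r ⟨i, j, s⟩ →
      h i j = lab r ∨ v i j = lab r := by
    intro i j hc r s hr
    have h1 := hr.label H
    have h2 := H.strands i j
    rw [hc] at h2
    obtain ⟨h3, h4, -⟩ := Strands.cross_eq h2
    cases s <;> simp only [cellLabels, sideLabels] at h1
    · exact Or.inr h1
    · exact Or.inl (h3.trans h1)
    · exact Or.inr (h4.trans h1)
    · exact Or.inl h1
  have hvis : ∀ i j, D i j = .cross → ∀ a : ℕ, h i j = a ∨ v i j = a →
      ∃ r, lab r = a ∧ ∃ s, Visits β D r ⟨i, j, s⟩ := by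
    intro i j hc a ha
    have h2 := H.strands i j
    rw [hc] at h2
    obtain ⟨h3, h4, -⟩ := Strands.cross_eq h2
    have hs : ∃ s, IsInput (β i) s ∧ cellLabels h v i j s = a := by
      rcases ha with ha | ha
      · cases hβ : β i
        · exact ⟨.W, trivial, ha⟩
        · exact ⟨.E, trivial, h3.symm.trans ha⟩
      · refine ⟨.S, ?_, h4.symm.trans ha⟩
        cases hβ : β i <;> trivial
    obtain ⟨s, hs, hsa⟩ := hs
    obtain ⟨r, hr⟩ := H.visits_input (m - (i + 1)) i (by omega) j s hs (by simp [hsa])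
    have h5 := hr.label H
    simp only at h5
    rw [hsa] at h5
    exact ⟨r, by exact_mod_cast h5.symm, s, hr⟩
  constructor
  · intro hx a b hab i j i' j' h1 h2
    have hr : ∀ {i j}, LabelsCross D h v i j a b → ∃ r r', lab r = a ∧ lab r' = b ∧
        CrossAt β D r r' i j := by
      rintro i j ⟨hc, hl⟩
      obtain ⟨r, hr, hs⟩ := hvis i j hc a (by tauto)
      obtain ⟨r', hr', hs'⟩ := hvis i j hc b (by tauto)
      exact ⟨r, r', hr, hr', by rintro rfl; omega, hc, hs, hs'⟩
    obtain ⟨r₁, r₁', rfl, rfl, hx1⟩ := hr h1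
    obtain ⟨r₂, r₂', e1, e2, hx2⟩ := hr h2
    obtain rfl := hlab e1
    obtain rfl := hlab e2
    exact hx _ _ _ _ _ _ hx1 hx2
  · intro hx r r' i j i' j' h1 h2
    have hl : ∀ {i j}, CrossAt β D r r' i j → LabelsCross D h v i j (lab r) (lab r') := by
      rintro i j ⟨hne, hc, ⟨s, hs⟩, s', hs'⟩
      refine ⟨hc, ?_⟩
      have hne' : (lab r : WithTop ℕ) ≠ lab r' := fun e => hne (hlab (by exact_mod_cast e))
      rcases hside i j hc r s hs with e1 | e1 <;> rcases hside i j hc r' s' hs' with e2 | e2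
      · exact absurd (e1.symm.trans e2) hne'
      · exact Or.inl ⟨e1, e2⟩
      · exact Or.inr ⟨e2, e1⟩
      · exact absurd (e1.symm.trans e2) hne'
    rcases lt_trichotomy (lab r) (lab r') with hlt | heq | hlt
    · exact hx _ _ hlt _ _ _ _ (hl h1) (hl h2)
    · exact absurd (hlab heq) h1.1
    · exact hx _ _ hlt _ _ _ _ ⟨(hl h1).1, (hl h1).2.symm⟩ ⟨(hl h2).1, (hl h2).2.symm⟩

/-! ### Existence of labellings -/

theorem exists_strands_west {t : Tile} (ht : t.Allowed .west) {W S : WithTop ℕ}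
    (hW : t.Touches .W ↔ W ≠ ⊤) (hS : t.Touches .S ↔ S ≠ ⊤) :
    ∃ N E, Strands t (sideLabels W S N E) := by
  cases t <;> simp [Tile.Touches, Tile.other, Side.opp, Tile.Allowed] at ht hW hS
  · exact ⟨⊤, ⊤, by simp [Strands, Side.forall_iff, Tile.other, sideLabels, hW, hS]⟩
  · exact ⟨⊤, W, by simp [Strands, Side.forall_iff, Tile.other, sideLabels, hW, hS]⟩
  · exact ⟨S, W, by simp [Strands, Side.forall_iff, Tile.other, Side.opp, sideLabels, hW, hS]⟩
  · exact ⟨W, ⊤, by simp [Strands, Side.forall_iff, Tile.other, sideLabels, hW, hS]⟩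
  · exact ⟨⊤, S, by simp [Strands, Side.forall_iff, Tile.other, sideLabels, hW, hS]⟩
  · exact ⟨W, S, by simp [Strands, Side.forall_iff, Tile.other, sideLabels, hW, hS]⟩

theorem exists_strands_east {t : Tile} (ht : t.Allowed .east) {S E : WithTop ℕ}
    (hE : t.Touches .E ↔ E ≠ ⊤) (hS : t.Touches .S ↔ S ≠ ⊤) :
    ∃ W N, Strands t (sideLabels W S N E) := by
  cases t <;> simp [Tile.Touches, Tile.other, Side.opp, Tile.Allowed] at ht hE hS
  · exact ⟨⊤, ⊤, by simp [Strands, Side.forall_iff, Tile.other, sideLabels, hE, hS]⟩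
  · exact ⟨E, ⊤, by simp [Strands, Side.forall_iff, Tile.other, sideLabels, hE, hS]⟩
  · exact ⟨⊤, S, by simp [Strands, Side.forall_iff, Tile.other, sideLabels, hE, hS]⟩
  · exact ⟨E, S, by simp [Strands, Side.forall_iff, Tile.other, Side.opp, sideLabels, hE, hS]⟩
  · exact ⟨⊤, E, by simp [Strands, Side.forall_iff, Tile.other, sideLabels, hE, hS]⟩
  · exact ⟨S, ⊤, by simp [Strands, Side.forall_iff, Tile.other, sideLabels, hE, hS]⟩

theorem exists_row_west {n : ℕ} (t : ℕ → Tile) (S : ℕ → WithTop ℕ) (a : WithTop ℕ)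
    (ht : ∀ j < n, (t j).Allowed .west)
    (hm : ∀ j, j + 1 < n → ((t j).Touches .E ↔ (t (j + 1)).Touches .W))
    (hS : ∀ j < n, ((t j).Touches .S ↔ S j ≠ ⊤)) (ha : 0 < n → ((t 0).Touches .W ↔ a ≠ ⊤)) :
    ∃ H N : ℕ → WithTop ℕ, H 0 = a ∧
      ∀ j < n, Strands (t j) (sideLabels (H j) (S j) (N j) (H (j + 1))) := by
  induction n with
  | zero => exact ⟨fun _ => a, fun _ => ⊤, rfl, fun j hj => by omega⟩
  | succ n ih =>
    obtain ⟨H, N, h0, hs⟩ := ih (fun j hj => ht j (by omega)) (fun j hj => hm j (by omega))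
      (fun j hj => hS j (by omega)) (fun hn => ha (by omega))
    have hW : (t n).Touches .W ↔ H n ≠ ⊤ := by
      rcases n with _ | n
      · rw [h0]
        exact ha (by omega)
      · rw [← hm n (by omega)]
        exact (hs n (by omega)).touches_iff .E
    obtain ⟨b, c, hbc⟩ := exists_strands_west (ht n (by omega)) hW (hS n (by omega))
    refine ⟨Function.update H (n + 1) c, Function.update N n b, ?_, fun j hj => ?_⟩
    · rw [Function.update_of_ne (by omega), h0]
    · rw [Function.update_of_ne (by omega : j ≠ n + 1)]
      by_cases hjn : j = n
      · subst hjn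
        rwa [Function.update_self, Function.update_self]
      · rw [Function.update_of_ne hjn, Function.update_of_ne (by omega)]
        exact hs j (by omega)

theorem exists_row_east {n : ℕ} (t : ℕ → Tile) (S : ℕ → WithTop ℕ) (a : WithTop ℕ)
    (ht : ∀ j < n, (t j).Allowed .east)
    (hm : ∀ j, j + 1 < n → ((t j).Touches .E ↔ (t (j + 1)).Touches .W))
    (hS : ∀ j < n, ((t j).Touches .S ↔ S j ≠ ⊤))
    (ha : ∀ j, j + 1 = n → ((t j).Touches .E ↔ a ≠ ⊤)) :
    ∃ H N : ℕ → WithTop ℕ, H n = a ∧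
      ∀ j < n, Strands (t j) (sideLabels (H j) (S j) (N j) (H (j + 1))) := by
  induction n generalizing a with
  | zero => exact ⟨fun _ => a, fun _ => ⊤, rfl, fun j hj => by omega⟩
  | succ n ih =>
    obtain ⟨b, c, hbc⟩ := exists_strands_east (ht n (by omega)) (ha n rfl) (hS n (by omega))
    obtain ⟨H, N, h0, hs⟩ := ih b (fun j hj => ht j (by omega)) (fun j hj => hm j (by omega))
      (fun j hj => hS j (by omega)) (fun j hj => by
        subst hj
        rw [hm j (by omega)]
        exact hbc.touches_iff .W)
    refine ⟨Function.update H (n + 1) a, Function.update N n c, ?_, fun j hj => ?_⟩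
    · rw [Function.update_self]
    · rw [Function.update_of_ne (by omega : j ≠ n + 1)]
      by_cases hjn : j = n
      · subst hjn
        rw [Function.update_self, Function.update_self, h0]
        exact hbc
      · rw [Function.update_of_ne hjn, Function.update_of_ne (by omega)]
        exact hs j (by omega)

/-- The labels are propagated from the entries, the rows being added from the bottom up. Without
columns the conditions at the two ends of a row would concern the same edge and contradict each
other, hence `hn`. -/
theorem exists_isPreLabelling (hn : 0 < m → 0 < n) (lab : Fin m → ℕ)
    (allowed : ∀ i j, (D i j).Allowed (β i))
    (matching : ∀ s i j i' j', Neighbor s i j i' j' →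
      ((D i j).Touches s ↔ (D i' j').Touches s.opp))
    (west_end : ∀ i j, j.val = 0 → ((D i j).Touches .W ↔ β i = .west))
    (east_end : ∀ i j, j.val + 1 = n → ((D i j).Touches .E ↔ β i = .east))
    (south_end : ∀ i j, i.val + 1 = m → ¬ (D i j).Touches .S) :
    ∃ h v, IsPreLabelling β lab D h v := by
  induction m with
  | zero =>
    exact ⟨fun _ _ => ⊤, fun _ _ => ⊤, fun i => i.elim0, fun i => i.elim0, fun i => i.elim0,
      fun i => i.elim0, fun _ => rfl⟩
  | succ m ih =>
    replace hn := hn m.succ_pos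
    obtain ⟨h, v, H⟩ := ih (β := fun i => β i.succ) (D := fun i => D i.succ) (fun _ => hn)
      (fun i => lab i.succ)
      (fun i => allowed i.succ)
      (fun s i j i' j' hN => matching s i.succ j i'.succ j' (by
        cases s <;> obtain ⟨h1, h2⟩ := hN <;> refine ⟨?_, h2⟩ <;> simp [h1]))
      (fun i => west_end i.succ) (fun i => east_end i.succ)
      (fun i j hi => south_end i.succ j (by simp; omega))
    have hS : ∀ j : Fin n, (D 0 j).Touches .S ↔ v 0 j ≠ ⊤ := by
      intro j
      rcases m with _ | m
      · rw [H.south j]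
        simpa using south_end 0 j rfl
      · rw [matching .S 0 j 1 j ⟨rfl, rfl⟩]
        exact (H.strands 0 j).touches_iff .N
    set t : ℕ → Tile := fun j => if hj : j < n then D 0 ⟨j, hj⟩ else .blank with ht
    have htj : ∀ j (hj : j < n), t j = D 0 ⟨j, hj⟩ := fun j hj => dif_pos hj
    have hm : ∀ j, j + 1 < n → ((t j).Touches .E ↔ (t (j + 1)).Touches .W) := by
      intro j hj
      rw [htj _ hj, htj j (by omega)]
      exact matching .E 0 _ 0 _ ⟨rfl, rfl⟩
    have hS' : ∀ j < n, ((t j).Touches .S ↔ v 0 j ≠ ⊤) := by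
      intro j hj
      rw [htj _ hj]
      exact hS ⟨j, hj⟩
    obtain ⟨r, N, h1, h2, h3⟩ : ∃ r N : ℕ → WithTop ℕ,
        r 0 = (if β 0 = .west then (lab 0 : WithTop ℕ) else ⊤) ∧
        r n = (if β 0 = .west then ⊤ else (lab 0 : WithTop ℕ)) ∧
        ∀ j < n, Strands (t j) (sideLabels (r j) (v 0 j) (N j) (r (j + 1))) := by
      cases hβ : β 0
      · obtain ⟨r, N, h1, h2⟩ := exists_row_west t (v 0) (lab 0)
          (fun j hj => by rw [htj _ hj, ← hβ]; exact allowed _ _) hm hS'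
          (fun hn => by rw [htj _ hn, west_end 0 _ rfl]; simp [hβ])
        refine ⟨r, N, by simpa using h1, ?_, h2⟩
        -- The propagation fixes the label on the West end only. The East end is empty because the
        -- last tile does not touch that side.
        have h3 := (h2 (n - 1) (by omega)).touches_iff .E
        rw [htj _ (by omega), east_end 0 _ (by simp only; omega), hβ] at h3
        simp only [reduceCtorEq, sideLabels, false_iff, not_not] at h3
        rw [show n - 1 + 1 = n by omega] at h3
        simpa using h3
      · obtain ⟨r, N, h1, h2⟩ := exists_row_east t (v 0) (lab 0)
          (fun j hj => by rw [htj _ hj, ← hβ]; exact allowed _ _) hm hS'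
          (fun j hj => by rw [htj _ (by omega), east_end 0 _ hj]; simp [hβ])
        refine ⟨r, N, ?_, by simpa using h1, h2⟩
        have h3 := (h2 0 hn).touches_iff .W
        rw [htj _ hn, west_end 0 _ rfl, hβ] at h3
        simp only [reduceCtorEq, sideLabels, false_iff, not_not] at h3
        simpa using h3
    refine ⟨consSeq r h, consSeq N v, allowed, fun i => ?_, fun i => ?_, fun i => ?_, H.south⟩
    · refine Fin.cases (fun j => ?_) (fun i => ?_) i
      · rw [← htj j j.isLt]
        exact h3 j j.isLt
      · exact H.strands i
    · exact Fin.cases h1 H.west i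
    · exact Fin.cases h2 H.east i

end

end HybridPipeDream

namespace HybridPipeDream

/-! ### The numbers of the pipes -/

theorem entersBefore_iff {m : ℕ} {β : Fin m → RowType} {a b : Fin m} :
    EntersBefore β a b ↔ (β a = .west ∧ β b = .west ∧ a < b) ∨ (β a = .west ∧ β b = .east) ∨
      (β a = .east ∧ β b = .east ∧ b < a) := by
  unfold EntersBefore
  cases β a <;> cases β b <;> simp

theorem EntersBefore.trans {m : ℕ} {β : Fin m → RowType} {a b c : Fin m}
    (h1 : EntersBefore β a b) (h2 : EntersBefore β b c) : EntersBefore β a c := by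
  rw [entersBefore_iff] at *
  grind

theorem entersBefore_or {m : ℕ} (β : Fin m → RowType) {a b : Fin m} (h : a ≠ b) :
    EntersBefore β a b ∨ EntersBefore β b a := by
  unfold EntersBefore
  cases β a <;> cases β b <;> simp only [true_or, or_true] <;>
    rcases lt_or_gt_of_ne h with h | h <;> simp [h]

open Classical in
theorem val_pipeNumber {m : ℕ} (β : Fin m → RowType) (r : Fin m) :
    (pipeNumber β r).val = (univ.filter fun r' => EntersBefore β r' r).card := rfl

theorem pipeNumber_lt {m : ℕ} {β : Fin m → RowType} {a b : Fin m} (h : EntersBefore β a b) :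
    pipeNumber β a < pipeNumber β b := by
  classical
  rw [Fin.lt_def, val_pipeNumber, val_pipeNumber]
  refine card_lt_card ((ssubset_iff_of_subset fun c hc => ?_).2 ⟨a, ?_, ?_⟩)
  · simp only [mem_filter, mem_univ, true_and] at hc ⊢
    exact hc.trans h
  · simpa using h
  · simpa using not_entersBefore_self β a

theorem pipeNumber_injective {m : ℕ} (β : Fin m → RowType) :
    Function.Injective (pipeNumber β) := by
  intro a b hab
  by_contra hne
  rcases entersBefore_or β hne with h | h
  · exact (pipeNumber_lt h).ne hab
  · exact (pipeNumber_lt h).ne' hab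

theorem isEntryOrder_pipeNumber {m : ℕ} (β : Fin m → RowType) :
    IsEntryOrder β fun i => (pipeNumber β i).val := by
  intro i r hr
  cases hβ : β i
  · refine pipeNumber_lt ?_
    unfold EntersBefore
    cases hβ' : β r <;> simp [hβ, hr]
  · refine pipeNumber_lt ?_
    unfold EntersBefore
    cases hβ' : β r <;> simp [hβ, hr]

theorem pipeNumber_zero {m : ℕ} (β : Fin (m + 1) → RowType) :
    (pipeNumber β 0).val = if β 0 = .west then 0 else m := by
  classical
  rw [val_pipeNumber]
  cases hβ : β 0
  · rw [if_pos rfl, card_eq_zero, filter_eq_empty_iff]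
    intro r _ h
    unfold EntersBefore at h
    cases hr : β r <;> simp [hβ, hr] at h
  · have : (univ.filter fun r' => EntersBefore β r' 0) = univ.erase 0 := by
      ext r
      simp only [mem_filter, mem_univ, true_and, mem_erase, and_true]
      refine ⟨?_, fun hr => ?_⟩
      · rintro h rfl
        exact not_entersBefore_self _ _ h
      · unfold EntersBefore
        cases hr' : β r <;> simp [hβ, Fin.pos_iff_ne_zero, hr]
    simp [this]

theorem pipeNumber_succ {m : ℕ} (β : Fin (m + 1) → RowType) (i : Fin m) :
    (pipeNumber β i.succ).val =
      (if β 0 = .west then 1 else 0) + (pipeNumber (fun i => β i.succ) i).val := by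
  classical
  have h0 : EntersBefore β 0 i.succ ↔ β 0 = .west := by
    unfold EntersBefore
    cases hβ : β 0 <;> cases hr : β i.succ <;> simp
  have hs : ∀ r : Fin m, EntersBefore β r.succ i.succ ↔ EntersBefore (fun i => β i.succ) r i := by
    intro r
    simp [entersBefore_iff]
  rw [val_pipeNumber, val_pipeNumber, Fin.card_filter_univ_succ]
  simp only [h0, hs]
  split_ifs <;> omega

/-- The pipe of the top row is the first in the counterclockwise order if it enters from the West
and the last if it enters from the East; this is the recursion in `IsNumbered`. -/
theorem isNumbered_ofFn {m : ℕ} (β : Fin m → RowType) (a : ℕ) :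
    IsNumbered a (List.ofFn fun i => (β i, a + (pipeNumber β i).val)) := by
  induction m generalizing a with
  | zero => trivial
  | succ m ih =>
    rw [List.ofFn_succ]
    simp only [pipeNumber_zero, pipeNumber_succ]
    cases hβ : β 0
    · refine ⟨by simp, ?_⟩
      simpa [add_assoc] using ih (fun i => β i.succ) (a + 1)
    · refine ⟨by simp, ?_⟩
      simpa using ih (fun i => β i.succ) a

/-! ### Pipe dreams and labellings -/

section

variable {m n : ℕ} {β : Fin m → RowType} {lab : Fin m → ℕ} {D : Filling m n}
  {h v : ℕ → ℕ → WithTop ℕ}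

/-- Labels outside the grid are unconstrained. Setting them to `⊤` makes the words along the rows
end at the East side. -/
theorem IsPreLabelling.truncate (H : IsPreLabelling β lab D h v) :
    IsPreLabelling β lab D h fun i k => if k < n then v i k else ⊤ where
  allowed := H.allowed
  strands i j := by simpa [cellLabels] using H.strands i j
  west := H.west
  east := H.east
  south j := by simpa using H.south j

/-- Connectivity only places the `m` labels. The other columns are empty because each label on the
top line belongs to some row and occurs only once there. -/
theorem hasConnectivity_iff (H : IsPreLabelling β (fun i => (pipeNumber β i).val) D h v)
    (hout : ∀ i k, n ≤ k → v i k = ⊤) (π : Fin m ↪ Fin n) (hmn : m ≤ n) :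
    HasConnectivity β D π ↔
      ∀ c : Fin n, v 0 c = permState (minimalExtension π) m c := by
  have hinj : Function.Injective fun i => (pipeNumber β i).val :=
    Fin.val_injective.comp (pipeNumber_injective β)
  have hstate : ∀ r, permState (minimalExtension π) m (π (pipeNumber β r)) =
      ((pipeNumber β r).val : WithTop ℕ) := by
    intro r
    rw [permState, ← minimalExtension_apply_lt hmn]
    simp
  have hw := wordInv_row H hout (isEntryOrder_pipeNumber β) m 0 (by omega)
  have hcon : HasConnectivity β D π ↔
      ∀ r, v 0 (π (pipeNumber β r)) = ((pipeNumber β r).val : WithTop ℕ) :=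
    forall_congr' fun r => H.exitsAt_iff hinj r _
  rw [hcon]
  refine ⟨fun hv c => ?_, fun hv r => by rw [hv, hstate]⟩
  by_cases hc : ((minimalExtension π)⁻¹ c).val < m
  · obtain ⟨r, hr⟩ := (Finite.injective_iff_surjective.1 (pipeNumber_injective β)) ⟨_, hc⟩
    have hcr : c = π (pipeNumber β r) := by
      rw [← minimalExtension_apply_lt hmn, hr]
      change c = minimalExtension π ((minimalExtension π)⁻¹ c)
      simp
    rw [hcr, hv, hstate]
  · rw [permState, if_neg hc]
    by_contra hne
    obtain ⟨r, -, hr⟩ := hw.rows _ hne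
    have hcr : c = π (pipeNumber β r) := Fin.ext (hw.inj _ _ _ hr (hv r))
    rw [hcr, ← minimalExtension_apply_lt hmn] at hc
    simp at hc

theorem isHybridPipeDream_and_hasConnectivity_iff (D : Filling m n) (π : Fin m ↪ Fin n)
    (hmn : m ≤ n) :
    IsHybridPipeDream β D ∧ HasConnectivity β D π ↔
      ∃ h v, IsLabelling β (fun i => (pipeNumber β i).val) D h v ∧
        (List.ofFn fun j : Fin n => v 0 j) = List.ofFn (permState (minimalExtension π) m) := by
  have hinj : Function.Injective fun i => (pipeNumber β i).val :=
    Fin.val_injective.comp (pipeNumber_injective β)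
  simp only [isLabelling_iff, List.ofFn_inj, funext_iff]
  constructor
  · rintro ⟨hD, hπ⟩
    obtain ⟨h, v, H⟩ := exists_isPreLabelling (fun hm => (π ⟨0, hm⟩).pos)
      (fun i => (pipeNumber β i).val) hD.allowed hD.matching hD.west_end hD.east_end hD.south_end
    have H' := H.truncate
    have hout : ∀ i k, n ≤ k → (if k < n then v i k else ⊤) = ⊤ := fun i k hk =>
      if_neg (by omega)
    exact ⟨h, _, ⟨H', (crossOrder_iff H' hout (isEntryOrder_pipeNumber β)).2
      ((H'.no_double_crossing_iff hinj).1 hD.no_double_crossing)⟩,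
      (hasConnectivity_iff H' hout π hmn).1 hπ⟩
  · rintro ⟨h, v, ⟨H, ho⟩, hv⟩
    have H' := H.truncate
    have hout : ∀ i k, n ≤ k → (if k < n then v i k else ⊤) = ⊤ := fun i k hk =>
      if_neg (by omega)
    have ho' : ∀ (i : Fin m) (j : Fin n), CrossOrder (β i) (D i j)
        (cellLabels h (fun i k => if k < n then v i k else ⊤) i j) := by
      intro i j
      simpa [cellLabels] using ho i j
    refine ⟨⟨H.allowed, fun s i j i' j' hN => ?_, fun i j hj => ?_, fun i j hj => ?_,
      fun i j hi => ?_, (H'.no_double_crossing_iff hinj).2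
      ((crossOrder_iff H' hout (isEntryOrder_pipeNumber β)).1 ho')⟩,
      (hasConnectivity_iff H' hout π hmn).2 fun c => by simpa using hv c⟩
    · rw [(H.strands i j).touches_iff, (H.strands i' j').touches_iff, cellLabels_of_neighbor hN]
    · rw [(H.strands i j).touches_iff]
      change h i j ≠ ⊤ ↔ _
      rw [hj, H.west]
      split_ifs with hβ <;> simp [hβ]
    · rw [(H.strands i j).touches_iff]
      change h i (j + 1) ≠ ⊤ ↔ _
      rw [hj, H.east]
      cases hβ : β i <;> simp
    · rw [(H.strands i j).touches_iff]
      change ¬ v (i + 1) j ≠ ⊤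
      rw [hi, H.south, not_not]

end

end HybridPipeDream

/-! ### Comparison of the two sums -/

theorem mainTheorem9 (m n : ℕ) (hmn : m ≤ n) (β : Fin m → HybridPipeDream.RowType)
    (π : Fin m ↪ Fin n) :
    MvPolynomial.rename (Sum.map (Fin.castLE hmn) id) (HybridPipeDream.pipeDreamSum β π) =
      DoubleSchubert.doubleSchubert (HybridPipeDream.minimalExtension π) := by
  classical
  have hnum := HybridPipeDream.isNumbered_ofFn β 0
  simp only [zero_add] at hnum
  rw [← HybridPipeDream.partitionFn_minimalExtension hmn π
    (List.ofFn fun i => (β i, (HybridPipeDream.pipeNumber β i).val)) (by simp) hnum,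
    HybridPipeDream.partitionFn_eq_sum _ _ _ _ _ (List.length_ofFn),
    HybridPipeDream.pipeDreamSum, map_sum, Finset.sum_filter]
  refine Finset.sum_congr rfl fun D _ => ?_
  rw [mul_ite, mul_one, mul_zero]
  refine if_congr (HybridPipeDream.isHybridPipeDream_and_hasConnectivity_iff D π hmn) ?_ rfl
  rw [map_prod]
  refine Finset.prod_congr rfl fun i _ => ?_
  rw [map_prod]
  refine Finset.prod_congr rfl fun j _ => ?_
  have hx : HybridPipeDream.xSeq n (HybridPipeDream.pipeNumber β i).val =
      MvPolynomial.X (Sum.inl (Fin.castLE hmn (HybridPipeDream.pipeNumber β i))) :=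
    dif_pos (lt_of_lt_of_le (Fin.isLt _) hmn)
  have hy : HybridPipeDream.ySeq n j.val = MvPolynomial.X (Sum.inr j) := dif_pos j.isLt
  rw [hx, hy]
  simp only [HybridPipeDream.tileWeight, HybridPipeDream.cellWeight]
  cases β i <;> simp only <;> split_ifs <;> simp
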